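/- Let $d\ge 1$ and let $\Omega\subset\mathbb R^d$ be a bounded domain (nonempty, open, connected) of class $\mathfrak N^{3,1}$: there are $a,b>0$, finitely many Cartesian coordinate systems $x=(x_r',x_r^d)\in\mathbb R^{d-1}\times\mathbb R$, $r=1,\dots,m$, and functions $a_r:\overline{\Delta}\to\mathbb R$ on the cube $\Delta=\{x':|x'_j|<a,\ j=1,\dots,d-1\}$, which together with their derivatives of order $\le 3$ are Lipschitz continuous on $\overline\Delta$, such that the sets $V_r=\{x_r'\in\Delta,\ |x_r^d-a_r(x_r')|<b\}$ cover $\partial\Omega$ and, for every $r$, $$V_r\cap\partial\Omega=\{x_r'\in\Delta,\ x_r^d=a_r(x_r')\},\qquad V_r\cap\Omega=\{x_r'\in\Delta,\ a_r(x_r')<x_r^d<a_r(x_r')+b\},$$ $$V_r\cap(\mathbb R^d\setminus\overline\Omega)=\{x_r'\in\Delta,\ a_r(x_r')-b<x_r^d<a_r(x_r')\}.$$ Fix such a system. For $1\le p<\infty$ let $W^{k,p}(\Omega)$ be the space of complex functions in $L^p(\Omega)$ whose weak derivatives of order $\le k$ are in $L^p(\Omega)$, with norm $\|u\|_{k,p,\Omega}=\big(\sum_{|\alpha|\le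 k}\int_\Omega|\partial^\alpha u|^p\,dx\big)^{1/p}$, and let $L^p(\partial\Omega)$ carry the norm $\|g\|_{p,\partial\Omega}=\big(\sum_{r=1}^m\int_{\Delta}|g(x_r',a_r(x_r'))|^p\,dx_r'\big)^{1/p}$. The trace of $f\in W^{1,p}(\Omega)$ is the limit in $L^p(\partial\Omega)$ of $\varphi_k|_{\partial\Omega}$, where $\varphi_k$ are functions in $C^\infty(\overline\Omega)$ (restrictions to $\overline\Omega$ of functions in $C^\infty(\mathbb R^d)$) with $\varphi_k\to f$ in $W^{1,p}(\Omega)$. Then for every $1\le p<\infty$ there is a constant $\hat c_p>0$ such that for every $u\in W^{3,p}(\Omega)$ the weak Laplacian $\Delta u=\sum_{j=1}^d\partial_j^2u$ belongs to $W^{1,p}(\Omega)$, has a trace in $L^p(\partial\Omega)$, and this trace satisfies $$\|\Delta u\|_{p,\partial\Omega}\le \hat c_p\,\|u\|_{2,p,\Omega}^{\frac{p-1}{p}}\,\|u\|_{3,p,\Omega}^{\frac1p}.$$ -/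

import Mathlib

open MeasureTheory Filter Topology
open scoped ContDiff NNReal ENNReal

noncomputable section

namespace SobolevTrace

/-- Euclidean space `ℝ^d`. -/
abbrev E (d : ℕ) : Type := EuclideanSpace ℝ (Fin d)

/-! ### Domains whose boundary is locally a graph -/

/-- The first `n` coordinates `x'` of a point `x = (x', x_d)` of `ℝ^d`, `d = n + 1`. -/
def headCoord {n : ℕ} (x : E (n + 1)) : E n := WithLp.toLp 2 (fun i : Fin n => x i.castSucc)

/-- The last coordinate `x_d` of a point `x = (x', x_d)` of `ℝ^d`, `d = n + 1`. -/
def lastCoord {n : ℕ} (x : E (n + 1)) : ℝ := x (Fin.last n)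

/-- The point `(x', t)` of `ℝ^d`, `d = n + 1`. -/
def joinCoord {n : ℕ} (x' : E n) (t : ℝ) : E (n + 1) :=
  WithLp.toLp 2 (Fin.snoc (α := fun _ => ℝ) (fun i : Fin n => x' i) t)

/-- The open cube `Δ = {x' : |x'_j| < a for all j}`. -/
def openCube (n : ℕ) (a : ℝ) : Set (E n) := {x' | ∀ j, |x' j| < a}

/-- The closed cube, the closure of `Δ` when `a > 0`. -/
def closedCube (n : ℕ) (a : ℝ) : Set (E n) := {x' | ∀ j, |x' j| ≤ a}

/-- A system of local (Cartesian) coordinates that describes the boundary of `Ω` as a graph.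
`coord r` gives the coordinates `(x_r', x_r^d)` of a point in the `r`-th system, and the set
`V_r = {x_r' ∈ Δ, a_r(x_r') - b < x_r^d < a_r(x_r') + b}` is the neighbourhood in which the boundary
is the graph of `a_r = graph r`, with `Ω` above the graph and the exterior of `Ω` below it. -/
structure LocalGraphSystem {n : ℕ} (Ω : Set (E (n + 1))) where
  m : ℕ
  a : ℝ
  b : ℝ
  a_pos : 0 < a
  b_pos : 0 < b
  coord : Fin m → (E (n + 1) ≃ᵃⁱ[ℝ] E (n + 1))
  graph : Fin m → E n → ℝ
  continuousOn_graph : ∀ r, ContinuousOn (graph r) (closedCube n a)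
  V : Fin m → Set (E (n + 1))
  V_eq : ∀ r, V r = {x | headCoord (coord r x) ∈ openCube n a ∧
    graph r (headCoord (coord r x)) - b < lastCoord (coord r x) ∧
    lastCoord (coord r x) < graph r (headCoord (coord r x)) + b}
  frontier_subset : frontier Ω ⊆ ⋃ r, V r
  V_inter_frontier : ∀ r, V r ∩ frontier Ω = {x | headCoord (coord r x) ∈ openCube n a ∧
    lastCoord (coord r x) = graph r (headCoord (coord r x))}
  V_inter_domain : ∀ r, V r ∩ Ω = {x | headCoord (coord r x) ∈ openCube n a ∧
    graph r (headCoord (coord r x)) < lastCoord (coord r x) ∧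
    lastCoord (coord r x) < graph r (headCoord (coord r x)) + b}
  V_inter_exterior : ∀ r, V r ∩ (closure Ω)ᶜ = {x | headCoord (coord r x) ∈ openCube n a ∧
    graph r (headCoord (coord r x)) - b < lastCoord (coord r x) ∧
    lastCoord (coord r x) < graph r (headCoord (coord r x))}

/-- The functions `a_r` are of class `C^{k,μ}` on the closed cube: together with their
derivatives of order `≤ k` they are Hölder continuous with exponent `μ` there. -/
def LocalGraphSystem.IsOfClass {n : ℕ} {Ω : Set (E (n + 1))} (S : LocalGraphSystem Ω)
    (k : ℕ) (μ : ℝ≥0) : Prop :=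
  ∀ r, ContDiffOn ℝ k (S.graph r) (closedCube n S.a) ∧
    ∀ j ≤ k, ∃ C : ℝ≥0,
      HolderOnWith C μ (iteratedFDerivWithin ℝ j (S.graph r) (closedCube n S.a))
        (closedCube n S.a)

/-- The boundary point of `Ω` whose coordinates in the `r`-th system are `(x', a_r(x'))`. -/
def LocalGraphSystem.boundaryPoint {n : ℕ} {Ω : Set (E (n + 1))} (S : LocalGraphSystem Ω)
    (r : Fin S.m) (x' : E n) : E (n + 1) :=
  (S.coord r).symm (joinCoord x' (S.graph r x'))

/-! ### The space `L^p(∂Ω)`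

Only the values of `g` on the boundary of `Ω` enter the next two definitions. -/

/-- `g ∈ L^p(∂Ω)`: each `x' ↦ g(x', a_r(x'))` belongs to `L^p(Δ)`. -/
def MemLpBoundary {n : ℕ} {Ω : Set (E (n + 1))} (S : LocalGraphSystem Ω) (p : ℝ)
    (g : E (n + 1) → ℂ) : Prop :=
  ∀ r, MemLp (fun x' => g (S.boundaryPoint r x')) (ENNReal.ofReal p)
    (volume.restrict (openCube n S.a))

/-- The norm of `L^p(∂Ω)`: the `p`-th root of `∑ r, ‖x' ↦ g(x', a_r(x'))‖ ^ p`, with the norms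
of `L^p(Δ)`. -/
def boundaryNorm {n : ℕ} {Ω : Set (E (n + 1))} (S : LocalGraphSystem Ω) (p : ℝ)
    (g : E (n + 1) → ℂ) : ℝ :=
  (∑ r, ∫ x' in openCube n S.a, ‖g (S.boundaryPoint r x')‖ ^ p) ^ (1 / p)

/-! ### Weak derivatives and Sobolev spaces -/

/-- The classical partial derivative `∂_i φ`. -/
def partialDeriv {d : ℕ} (i : Fin d) (φ : E d → ℝ) : E d → ℝ :=
  fun x => fderiv ℝ φ x (EuclideanSpace.single i 1)

/-- The classical derivative `∂^α φ = ∂_1^{α_1} ⋯ ∂_d^{α_d} φ`. -/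
def multiDeriv {d : ℕ} (α : Fin d → ℕ) (φ : E d → ℝ) : E d → ℝ :=
  (List.finRange d).foldr (fun i ψ => (partialDeriv i)^[α i] ψ) φ

/-- `v` is the weak derivative `∂^α u` in `Ω`. -/
def IsWeakDeriv {d : ℕ} (Ω : Set (E d)) (α : Fin d → ℕ) (u v : E d → ℂ) : Prop :=
  LocallyIntegrableOn v Ω ∧
    ∀ φ : E d → ℝ, ContDiff ℝ ∞ φ → HasCompactSupport φ → tsupport φ ⊆ Ω →
      ∫ x in Ω, multiDeriv α φ x • u x = (-1 : ℝ) ^ (∑ i, α i) • ∫ x in Ω, φ x • v x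

open Classical in
/-- The weak derivative `∂^α u` in `Ω` (a representative of it; zero if there is none). -/
def weakDeriv {d : ℕ} (Ω : Set (E d)) (α : Fin d → ℕ) (u : E d → ℂ) : E d → ℂ :=
  if h : ∃ v, IsWeakDeriv Ω α u v then h.choose else 0

/-- `u ∈ W^{m,p}(Ω)`. -/
def MemSobolev {d : ℕ} (Ω : Set (E d)) (m : ℕ) (p : ℝ) (u : E d → ℂ) : Prop :=
  MemLp u (ENNReal.ofReal p) (volume.restrict Ω) ∧
    ∀ α : Fin d → ℕ, ∑ i, α i ≤ m →
      ∃ v, MemLp v (ENNReal.ofReal p) (volume.restrict Ω) ∧ IsWeakDeriv Ω α u v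

/-- The multi-indices `α` with `|α| ≤ m`. -/
def multiIndices (d m : ℕ) : Finset (Fin d → ℕ) :=
  (Fintype.piFinset fun _ => Finset.range (m + 1)).filter fun α => ∑ i, α i ≤ m

theorem mem_multiIndices {d m : ℕ} {α : Fin d → ℕ} :
    α ∈ multiIndices d m ↔ ∑ i, α i ≤ m := by
  simp only [multiIndices, Finset.mem_filter, Fintype.mem_piFinset, Finset.mem_range,
    and_iff_right_iff_imp]
  intro h i
  have := Finset.single_le_sum (f := α) (fun _ _ => Nat.zero_le _) (Finset.mem_univ i)
  omega

/-- The norm `‖u‖_{m,p,Ω} = (∑_{|α| ≤ m} ∫_Ω |∂^α u|^p dx)^{1/p}` of `W^{m,p}(Ω)`. -/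
def sobolevNorm {d : ℕ} (Ω : Set (E d)) (m : ℕ) (p : ℝ) (u : E d → ℂ) : ℝ :=
  (∑ α ∈ multiIndices d m, ∫ x in Ω, ‖weakDeriv Ω α u x‖ ^ p) ^ (1 / p)

/-- The weak Laplacian `Δu = ∑ j, ∂_j² u`. -/
def weakLaplacian {d : ℕ} (Ω : Set (E d)) (u : E d → ℂ) : E d → ℂ :=
  fun x => ∑ j, weakDeriv Ω (Pi.single j 2) u x

/-! ### Traces -/

/-- `g ∈ L^p(∂Ω)` is the trace of `f ∈ W^{1,p}(Ω)`, i.e. the value at `f` of the continuous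
extension of the restriction `φ ↦ φ|_{∂Ω}`, `φ ∈ C^∞(closure Ω)`, to `W^{1,p}(Ω)`: some sequence of
functions smooth up to the boundary converges to `f` in `W^{1,p}(Ω)` while its boundary values
converge to `g` in `L^p(∂Ω)`. -/
def IsTrace {n : ℕ} {Ω : Set (E (n + 1))} (S : LocalGraphSystem Ω) (p : ℝ)
    (f g : E (n + 1) → ℂ) : Prop :=
  MemSobolev Ω 1 p f ∧ MemLpBoundary S p g ∧
    ∃ φ : ℕ → E (n + 1) → ℂ, (∀ k, ContDiff ℝ ∞ (φ k)) ∧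
      Tendsto (fun k => sobolevNorm Ω 1 p (φ k - f)) atTop (𝓝 0) ∧
      Tendsto (fun k => boundaryNorm S p (φ k - g)) atTop (𝓝 0)

end SobolevTrace

end

/-! The estimate is the multiplicative trace inequality in `W^{1,p}(Ω)`, applied to `f = Δu`. With
`d = n + 1`, the `L^p` norm of `f` is at most `d ‖u‖_{2,p}`. The norms of `f` and of its `d` first
derivatives add up to at most `(d + 1) d ‖u‖_{3,p}`
(`MemSobolev.lpNorm_weakDeriv_weakLaplacian_le`).

For `φ` of class `C¹` up to the boundary, follow `φ` from a boundary point along the inward axis of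
a chart, over length `b`. The fundamental theorem of calculus for `|φ|^p`, averaged over the
endpoint, bounds `|φ|^p` at the boundary point by the integral of `b⁻¹ |φ|^p + p |φ|^(p-1) |∂φ|`
over the segment (`norm_rpow_le_integral`). These segments sweep out part of `Ω` without Jacobian
(`lintegral_boundaryPoint_add_le`). Hölder's inequality then leaves `‖φ‖^(p-1) (‖φ‖ + ‖∇φ‖)`, whose
`p`-th root has the required form (`exists_boundaryNorm_le`).

Passing to `W^{1,p}(Ω)` needs density of functions smooth up to the boundary
(`exists_contDiff_approx`). A partition of unity subordinate to `Ω` and the charts cuts `f` into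
pieces. Each piece is extended by zero and mollified with a kernel whose centre is displaced so that
values are sampled slightly further inside; the jump across `∂Ω` is then not seen from `Ω`. The
inequality makes the boundary values of the approximations Cauchy, which gives a trace
(`exists_isTrace`), and it survives the limit for every trace (`exists_boundaryNorm_trace_le`). -/

noncomputable section

namespace SobolevTrace

/-! ### Classical partial derivatives -/

section Classical

variable {d : ℕ}

theorem contDiff_partialDeriv (i : Fin d) {φ : E d → ℝ} (hφ : ContDiff ℝ ∞ φ) :
    ContDiff ℝ ∞ (partialDeriv i φ) := by
  unfold partialDeriv
  exact (hφ.fderiv_right (m := ∞) (by simp)).clm_apply contDiff_const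

theorem partialDeriv_comm (i j : Fin d) {φ : E d → ℝ} (hφ : ContDiff ℝ ∞ φ) :
    partialDeriv i (partialDeriv j φ) = partialDeriv j (partialDeriv i φ) := by
  have key : ∀ (v w : E d) (x : E d), fderiv ℝ (fun y => fderiv ℝ φ y v) x w =
      fderiv ℝ (fderiv ℝ φ) x w v := by
    intro v w x
    have hd : DifferentiableAt ℝ (fderiv ℝ φ) x :=
      ((hφ.fderiv_right (m := ∞) (by simp)).differentiable (by simp)) x
    rw [fderiv_clm_apply hd (differentiableAt_const v)]
    simp
  funext x
  unfold partialDeriv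
  rw [key, key]
  have hsymm : IsSymmSndFDerivAt ℝ φ x := by
    apply (hφ.contDiffAt (x := x)).isSymmSndFDerivAt
    simp only [minSmoothness_of_isRCLikeNormedField]
    exact WithTop.coe_le_coe.2 (le_top : (2 : ℕ∞) ≤ ⊤)
  exact hsymm _ _

/-- The partial derivative as a self-map of the smooth functions. -/
def smoothPartial (i : Fin d) (φ : {φ : E d → ℝ // ContDiff ℝ ∞ φ}) :
    {φ : E d → ℝ // ContDiff ℝ ∞ φ} :=
  ⟨partialDeriv i φ.1, contDiff_partialDeriv i φ.2⟩

/-- With smoothness carried by the type, symmetry of second derivatives becomes an unconditional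
commutation, and the `Function.Commute` lemmas on iterates apply. -/
theorem smoothPartial_commute (i j : Fin d) :
    Function.Commute (smoothPartial i) (smoothPartial j) :=
  fun φ => Subtype.ext (partialDeriv_comm i j φ.2)

/-- Iterated partial derivatives in the directions of a list. -/
def smoothMulti (l : List (Fin d)) (α : Fin d → ℕ) (φ : {φ : E d → ℝ // ContDiff ℝ ∞ φ}) :
    {φ : E d → ℝ // ContDiff ℝ ∞ φ} :=
  l.foldr (fun i ψ => (smoothPartial i)^[α i] ψ) φ

theorem coe_smoothPartial_iterate (i : Fin d) (k : ℕ) (φ : {φ : E d → ℝ // ContDiff ℝ ∞ φ}) :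
    ((smoothPartial i)^[k] φ).1 = (partialDeriv i)^[k] φ.1 := by
  induction k generalizing φ with
  | zero => rfl
  | succ k ih => rw [Function.iterate_succ_apply, Function.iterate_succ_apply, ih]; rfl

theorem coe_smoothMulti (l : List (Fin d)) (α : Fin d → ℕ)
    (φ : {φ : E d → ℝ // ContDiff ℝ ∞ φ}) :
    (smoothMulti l α φ).1 = l.foldr (fun i ψ => (partialDeriv i)^[α i] ψ) φ.1 := by
  induction l with
  | nil => rfl
  | cons a l ih =>
    simp only [smoothMulti, List.foldr_cons] at ih ⊢
    rw [coe_smoothPartial_iterate, ih]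

theorem smoothMulti_commute (l : List (Fin d)) (α : Fin d → ℕ) (i : Fin d) (k : ℕ) :
    Function.Commute (smoothPartial i)^[k] (smoothMulti l α) := by
  induction l with
  | nil => exact fun φ => rfl
  | cons a l ih =>
    intro φ
    simp only [smoothMulti, List.foldr_cons] at ih ⊢
    rw [((smoothPartial_commute i a).iterate_iterate k (α a)).eq]
    congr 1
    exact ih φ

theorem smoothMulti_add (l : List (Fin d)) (α β : Fin d → ℕ)
    (φ : {φ : E d → ℝ // ContDiff ℝ ∞ φ}) :
    smoothMulti l (α + β) φ = smoothMulti l β (smoothMulti l α φ) := by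
  induction l with
  | nil => rfl
  | cons a l ih =>
    have h := (smoothMulti_commute l β a (α a)).eq (smoothMulti l α φ)
    simp only [smoothMulti, List.foldr_cons] at ih h ⊢
    rw [← h, ih, Pi.add_apply, add_comm, Function.iterate_add_apply]

theorem contDiff_multiDeriv (α : Fin d → ℕ) {φ : E d → ℝ} (hφ : ContDiff ℝ ∞ φ) :
    ContDiff ℝ ∞ (multiDeriv α φ) := by
  have h := coe_smoothMulti (List.finRange d) α ⟨φ, hφ⟩
  rw [multiDeriv, ← h]
  exact Subtype.prop _

/-- Needed to compose weak derivatives: in `IsWeakDeriv.of_add` the derivatives fall on the test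
function. -/
theorem multiDeriv_add (α β : Fin d → ℕ) {φ : E d → ℝ} (hφ : ContDiff ℝ ∞ φ) :
    multiDeriv (α + β) φ = multiDeriv β (multiDeriv α φ) := by
  have h := congrArg Subtype.val (smoothMulti_add (List.finRange d) α β ⟨φ, hφ⟩)
  rw [coe_smoothMulti, coe_smoothMulti, coe_smoothMulti] at h
  exact h

theorem foldr_partialDeriv_single (i : Fin d) (φ : E d → ℝ) (l : List (Fin d)) (hl : l.Nodup) :
    l.foldr (fun j ψ => (partialDeriv j)^[(Pi.single i 1 : Fin d → ℕ) j] ψ) φ =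
      if i ∈ l then partialDeriv i φ else φ := by
  induction l with
  | nil => simp
  | cons a l ih =>
    rw [List.nodup_cons] at hl
    rw [List.foldr_cons, ih hl.2]
    by_cases h : a = i
    · subst h; simp [hl.1]
    · simp [h, Ne.symm h]

@[simp]
theorem multiDeriv_single (i : Fin d) (φ : E d → ℝ) :
    multiDeriv (Pi.single i 1) φ = partialDeriv i φ := by
  rw [multiDeriv, foldr_partialDeriv_single i φ _ (List.nodup_finRange d)]
  simp

@[simp]
theorem multiDeriv_zero (φ : E d → ℝ) : multiDeriv (0 : Fin d → ℕ) φ = φ := by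
  unfold multiDeriv
  induction List.finRange d with
  | nil => rfl
  | cons a l ih => rw [List.foldr_cons, ih]; rfl

theorem tsupport_partialDeriv_subset (i : Fin d) (φ : E d → ℝ) :
    tsupport (partialDeriv i φ) ⊆ tsupport φ :=
  tsupport_fderiv_apply_subset ℝ _

theorem tsupport_multiDeriv_subset (α : Fin d → ℕ) (φ : E d → ℝ) :
    tsupport (multiDeriv α φ) ⊆ tsupport φ := by
  unfold multiDeriv
  induction List.finRange d with
  | nil => exact subset_rfl
  | cons a l ih =>
    rw [List.foldr_cons]
    refine Set.Subset.trans ?_ ih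
    induction α a with
    | zero => exact subset_rfl
    | succ k ihk =>
      rw [Function.iterate_succ_apply']
      exact (tsupport_partialDeriv_subset a _).trans ihk

end Classical

/-! ### Weak derivatives -/

section Weak

variable {d : ℕ} {Ω : Set (E d)}

theorem integrable_test_smul {v : E d → ℂ} (hv : LocallyIntegrableOn v Ω) {φ : E d → ℝ}
    (hφ : Continuous φ) (hc : HasCompactSupport φ) (hs : tsupport φ ⊆ Ω) :
    Integrable (fun x => φ x • v x) := by
  have h1 : IntegrableOn v (tsupport φ) := hv.integrableOn_compact_subset hs hc
  have h2 : IntegrableOn (fun x => φ x • v x) (tsupport φ) :=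
    h1.continuousOn_smul hφ.continuousOn hc
  refine (integrableOn_iff_integrable_of_support_subset ?_).1 h2
  intro x hx
  apply subset_tsupport
  intro h
  apply hx
  simp [h]

theorem setIntegral_test_smul {φ : E d → ℝ} (hs : tsupport φ ⊆ Ω) (v : E d → ℂ) :
    ∫ x in Ω, φ x • v x = ∫ x, φ x • v x := by
  apply setIntegral_eq_integral_of_forall_compl_eq_zero
  intro x hx
  rw [image_eq_zero_of_notMem_tsupport (fun h => hx (hs h)), zero_smul]

/-- The fundamental lemma of the calculus of variations, applied to `v - w`. It makes the choice of
representative in `weakDeriv` harmless. -/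
theorem IsWeakDeriv.ae_eq (hΩ : IsOpen Ω) {α : Fin d → ℕ} {u v w : E d → ℂ}
    (hv : IsWeakDeriv Ω α u v) (hw : IsWeakDeriv Ω α u w) : v =ᵐ[volume.restrict Ω] w := by
  have h : ∀ᵐ x, x ∈ Ω → (v - w) x = 0 := by
    refine hΩ.ae_eq_zero_of_integral_contDiff_smul_eq_zero (hv.1.sub hw.1) ?_
    intro φ h1 h2 h3
    have e1 := hv.2 φ h1 h2 h3
    rw [hw.2 φ h1 h2 h3, setIntegral_test_smul h3, setIntegral_test_smul h3] at e1
    have e2 : ∫ x, φ x • w x = ∫ x, φ x • v x := by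
      exact smul_right_injective ℂ (pow_ne_zero (∑ i, α i) (by norm_num : (-1 : ℝ) ≠ 0)) e1
    simp only [Pi.sub_apply, smul_sub]
    rw [integral_sub (integrable_test_smul hv.1 h1.continuous h2 h3)
      (integrable_test_smul hw.1 h1.continuous h2 h3), e2, sub_self]
  rw [EventuallyEq, ae_restrict_iff' hΩ.measurableSet]
  filter_upwards [h] with x hx hxΩ
  exact sub_eq_zero.1 (hx hxΩ)

theorem isWeakDeriv_weakDeriv {α : Fin d → ℕ} {u v : E d → ℂ} (hv : IsWeakDeriv Ω α u v) :
    IsWeakDeriv Ω α u (weakDeriv Ω α u) := by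
  have h : ∃ v, IsWeakDeriv Ω α u v := ⟨v, hv⟩
  rw [weakDeriv, dif_pos h]
  exact h.choose_spec

theorem IsWeakDeriv.weakDeriv_ae_eq (hΩ : IsOpen Ω) {α : Fin d → ℕ} {u v : E d → ℂ}
    (hv : IsWeakDeriv Ω α u v) : weakDeriv Ω α u =ᵐ[volume.restrict Ω] v :=
  (isWeakDeriv_weakDeriv hv).ae_eq hΩ hv

theorem isWeakDeriv_zero {u : E d → ℂ} (hu : LocallyIntegrableOn u Ω) :
    IsWeakDeriv Ω 0 u u :=
  ⟨hu, fun φ _ _ _ => by simp⟩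

theorem IsWeakDeriv.sub {α : Fin d → ℕ} {u₁ u₂ v₁ v₂ : E d → ℂ}
    (hu₁ : LocallyIntegrableOn u₁ Ω) (hu₂ : LocallyIntegrableOn u₂ Ω)
    (h₁ : IsWeakDeriv Ω α u₁ v₁) (h₂ : IsWeakDeriv Ω α u₂ v₂) :
    IsWeakDeriv Ω α (u₁ - u₂) (v₁ - v₂) := by
  refine ⟨h₁.1.sub h₂.1, fun φ a1 a2 a3 => ?_⟩
  have t := tsupport_multiDeriv_subset α φ
  have c := contDiff_multiDeriv α a1
  have b2 : HasCompactSupport (multiDeriv α φ) := a2.of_isClosed_subset (isClosed_tsupport _) t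
  simp only [Pi.sub_apply, smul_sub]
  rw [integral_sub (integrable_test_smul hu₁ c.continuous b2 (t.trans a3)).integrableOn
      (integrable_test_smul hu₂ c.continuous b2 (t.trans a3)).integrableOn,
    integral_sub (integrable_test_smul h₁.1 a1.continuous a2 a3).integrableOn
      (integrable_test_smul h₂.1 a1.continuous a2 a3).integrableOn, h₁.2 φ a1 a2 a3,
    h₂.2 φ a1 a2 a3, smul_sub]

theorem IsWeakDeriv.sum {ι : Type*} (s : Finset ι) {α : Fin d → ℕ} {u v : ι → E d → ℂ}
    (hu : ∀ j ∈ s, LocallyIntegrableOn (u j) Ω) (h : ∀ j ∈ s, IsWeakDeriv Ω α (u j) (v j)) :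
    IsWeakDeriv Ω α (fun x => ∑ j ∈ s, u j x) (fun x => ∑ j ∈ s, v j x) := by
  classical
  refine ⟨?_, fun φ a1 a2 a3 => ?_⟩
  · induction s using Finset.induction_on with
    | empty =>
      simpa using (continuous_const (y := (0 : ℂ))).locallyIntegrable.locallyIntegrableOn Ω
    | insert a s ha ih =>
      simp only [Finset.sum_insert ha]
      exact (h a (by simp)).1.add (ih (fun j hj => hu j (by simp [hj]))
        (fun j hj => h j (by simp [hj])))
  · have t := tsupport_multiDeriv_subset α φ
    have c := contDiff_multiDeriv α a1
    have b2 : HasCompactSupport (multiDeriv α φ) := a2.of_isClosed_subset (isClosed_tsupport _) t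
    simp only [Finset.smul_sum]
    rw [integral_finsetSum _ fun j hj =>
        (integrable_test_smul (hu j hj) c.continuous b2 (t.trans a3)).integrableOn,
      integral_finsetSum _ fun j hj =>
        (integrable_test_smul (h j hj).1 a1.continuous a2 a3).integrableOn, Finset.smul_sum]
    exact Finset.sum_congr rfl fun j hj => (h j hj).2 φ a1 a2 a3

/-- If `v = ∂^β u` and `w = ∂^(β + α) u` weakly, then `w = ∂^α v` weakly. -/
theorem IsWeakDeriv.of_add {α β : Fin d → ℕ} {u v w : E d → ℂ}
    (hv : IsWeakDeriv Ω β u v) (hw : IsWeakDeriv Ω (β + α) u w) : IsWeakDeriv Ω α v w := by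
  refine ⟨hw.1, fun φ a1 a2 a3 => ?_⟩
  have t := tsupport_multiDeriv_subset α φ
  have c := contDiff_multiDeriv α a1
  have b2 : HasCompactSupport (multiDeriv α φ) := a2.of_isClosed_subset (isClosed_tsupport _) t
  -- `v` is tested with `∂^α φ` and `w` with `φ`; the two copies of the sign `(-1)^|β|` cancel.
  have e1 := hv.2 _ c b2 (t.trans a3)
  have e2 := hw.2 φ a1 a2 a3
  rw [add_comm, multiDeriv_add α β a1, e1] at e2
  have : (-1 : ℝ) ^ (∑ i, β i) * (-1 : ℝ) ^ (∑ i, β i) = 1 := by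
    rw [← mul_pow]; simp
  calc ∫ x in Ω, multiDeriv α φ x • v x
      = (-1 : ℝ) ^ (∑ i, β i) • (-1 : ℝ) ^ (∑ i, β i) • ∫ x in Ω, multiDeriv α φ x • v x := by
        rw [smul_smul, this, one_smul]
    _ = _ := by
        rw [e2, smul_smul]
        congr 1
        simp only [Pi.add_apply, Finset.sum_add_distrib, pow_add]
        linear_combination (-1 : ℝ) ^ (∑ i, α i) * this

/-- Classical derivatives of a `C¹` function are weak derivatives. -/
theorem isWeakDeriv_of_contDiff {φ : E d → ℂ} (hφ : ContDiff ℝ 1 φ) (i : Fin d) :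
    IsWeakDeriv Ω (Pi.single i 1) φ (fun x => fderiv ℝ φ x (EuclideanSpace.single i 1)) := by
  have hcont : Continuous (fun x => fderiv ℝ φ x (EuclideanSpace.single i 1)) :=
    (hφ.continuous_fderiv (by simp)).clm_apply continuous_const
  refine ⟨hcont.locallyIntegrable.locallyIntegrableOn Ω, fun ψ a1 a2 a3 => ?_⟩
  have t := tsupport_partialDeriv_subset i ψ
  have c := contDiff_partialDeriv i a1
  have b2 : HasCompactSupport (partialDeriv i ψ) := a2.of_isClosed_subset (isClosed_tsupport _) t
  rw [multiDeriv_single, setIntegral_test_smul (t.trans a3), setIntegral_test_smul a3]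
  have hu := hφ.continuous.locallyIntegrable (μ := volume) |>.locallyIntegrableOn Set.univ
  have hv := hcont.locallyIntegrable (μ := volume) |>.locallyIntegrableOn Set.univ
  have := integral_smul_fderiv_eq_neg_fderiv_smul_of_integrable (𝕜 := ℝ) (μ := volume)
    (f := ψ) (g := φ) (v := EuclideanSpace.single i 1)
    (integrable_test_smul hu c.continuous b2 (Set.subset_univ _))
    (integrable_test_smul hv a1.continuous a2 (Set.subset_univ _))
    (integrable_test_smul hu a1.continuous a2 (Set.subset_univ _))
    (fun x _ => (a1.differentiable (by simp)) x)
    (fun x _ => (hφ.differentiable (by simp)) x)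
  rw [this]
  simp [partialDeriv]

end Weak

/-! ### Sobolev spaces -/

section Sobolev

variable {d : ℕ} {Ω : Set (E d)} {m : ℕ} {p : ℝ} {u : E d → ℂ}

theorem one_le_ofReal (hp : 1 ≤ p) : (1 : ℝ≥0∞) ≤ ENNReal.ofReal p := by
  rwa [ENNReal.one_le_ofReal]

theorem locallyIntegrableOn_of_memLp (hp : 1 ≤ p) {v : E d → ℂ}
    (hv : MemLp v (ENNReal.ofReal p) (volume.restrict Ω)) : LocallyIntegrableOn v Ω :=
  locallyIntegrableOn_of_locallyIntegrable_restrict (hv.locallyIntegrable (one_le_ofReal hp))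

theorem MemSobolev.locallyIntegrableOn (hu : MemSobolev Ω m p u) (hp : 1 ≤ p) :
    LocallyIntegrableOn u Ω :=
  locallyIntegrableOn_of_memLp hp hu.1

theorem MemSobolev.isWeakDeriv (hu : MemSobolev Ω m p u) {α : Fin d → ℕ}
    (hα : ∑ i, α i ≤ m) : IsWeakDeriv Ω α u (weakDeriv Ω α u) := by
  obtain ⟨v, -, hv⟩ := hu.2 α hα
  exact isWeakDeriv_weakDeriv hv

theorem MemSobolev.memLp_weakDeriv (hΩ : IsOpen Ω) (hu : MemSobolev Ω m p u) {α : Fin d → ℕ}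
    (hα : ∑ i, α i ≤ m) : MemLp (weakDeriv Ω α u) (ENNReal.ofReal p) (volume.restrict Ω) := by
  obtain ⟨v, hm, hv⟩ := hu.2 α hα
  exact hm.ae_eq (hv.weakDeriv_ae_eq hΩ).symm

theorem MemSobolev.mono (hu : MemSobolev Ω m p u) {k : ℕ} (hk : k ≤ m) : MemSobolev Ω k p u :=
  ⟨hu.1, fun α hα => hu.2 α (hα.trans hk)⟩

/-- Passes from the integrals that define the Sobolev and boundary norms to `lpNorm`, where
Minkowski's inequality is available. -/
theorem lpNorm_rpow_eq {X F : Type*} [MeasurableSpace X] [NormedAddCommGroup F] {μ : Measure X}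
    {p : ℝ} (hp : 1 ≤ p) {v : X → F}
    (hv : AEStronglyMeasurable v μ) :
    lpNorm v (ENNReal.ofReal p) μ ^ p = ∫ x, ‖v x‖ ^ p ∂μ := by
  have hp0 : 0 < p := by linarith
  rw [lpNorm_eq_integral_norm_rpow_toReal (by simpa using hp0) (by simp) hv,
    ENNReal.toReal_ofReal hp0.le, Real.rpow_inv_rpow _ hp0.ne']
  exact integral_nonneg fun x => by positivity

theorem lpNorm_congr {X : Type*} [MeasurableSpace X] {μ : Measure X} {q : ℝ≥0∞} {v w : X → ℂ}
    (h : v =ᵐ[μ] w) : lpNorm v q μ = lpNorm w q μ := by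
  -- `lpNorm` takes a default value on functions that are not a.e. strongly measurable, so that case
  -- is separate.
  by_cases hv : AEStronglyMeasurable v μ
  · rw [← toReal_eLpNorm hv, ← toReal_eLpNorm (hv.congr h), eLpNorm_congr_ae h]
  · rw [lpNorm_of_not_aestronglyMeasurable hv, lpNorm_of_not_aestronglyMeasurable
      fun hw => hv (hw.congr h.symm)]

theorem MemSobolev.sobolevNorm_eq (hΩ : IsOpen Ω) (hp : 1 ≤ p) (hu : MemSobolev Ω m p u) :
    sobolevNorm Ω m p u = (∑ α ∈ multiIndices d m,
      lpNorm (weakDeriv Ω α u) (ENNReal.ofReal p) (volume.restrict Ω) ^ p) ^ (1 / p) := by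
  unfold sobolevNorm
  congr 1
  refine Finset.sum_congr rfl fun α hα => ?_
  rw [lpNorm_rpow_eq hp (hu.memLp_weakDeriv hΩ (mem_multiIndices.1 hα)).1]

theorem sobolevNorm_nonneg : 0 ≤ sobolevNorm Ω m p u :=
  Real.rpow_nonneg (Finset.sum_nonneg fun _ _ => integral_nonneg fun _ => by positivity) _

theorem MemSobolev.lpNorm_weakDeriv_le (hΩ : IsOpen Ω) (hp : 1 ≤ p) (hu : MemSobolev Ω m p u)
    {α : Fin d → ℕ} (hα : ∑ i, α i ≤ m) :
    lpNorm (weakDeriv Ω α u) (ENNReal.ofReal p) (volume.restrict Ω) ≤ sobolevNorm Ω m p u := by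
  have hp0 : 0 < p := by linarith
  rw [hu.sobolevNorm_eq hΩ hp]
  have h : lpNorm (weakDeriv Ω α u) (ENNReal.ofReal p) (volume.restrict Ω) ^ p ≤
      ∑ α ∈ multiIndices d m,
        lpNorm (weakDeriv Ω α u) (ENNReal.ofReal p) (volume.restrict Ω) ^ p :=
    Finset.single_le_sum (f := fun α =>
      lpNorm (weakDeriv Ω α u) (ENNReal.ofReal p) (volume.restrict Ω) ^ p)
      (fun _ _ => Real.rpow_nonneg lpNorm_nonneg _) (mem_multiIndices.2 hα)
  calc _ = (lpNorm (weakDeriv Ω α u) (ENNReal.ofReal p) (volume.restrict Ω) ^ p) ^ (1 / p) := by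
        rw [one_div, Real.rpow_rpow_inv lpNorm_nonneg hp0.ne']
    _ ≤ _ := Real.rpow_le_rpow (Real.rpow_nonneg lpNorm_nonneg _) h (by positivity)

theorem sum_single_eq (i : Fin d) (k : ℕ) : ∑ j, (Pi.single i k : Fin d → ℕ) j = k := by
  simp

theorem MemSobolev.isWeakDeriv_weakLaplacian (hΩ : IsOpen Ω) (hp : 1 ≤ p) {γ : Fin d → ℕ}
    (hu : MemSobolev Ω m p u) (hγ : 2 + ∑ i, γ i ≤ m) :
    IsWeakDeriv Ω γ (weakLaplacian Ω u)
      (fun x => ∑ j, weakDeriv Ω (Pi.single j 2 + γ) u x) := by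
  refine IsWeakDeriv.sum _ (fun j _ => ?_) (fun j _ => ?_)
  · exact locallyIntegrableOn_of_memLp hp (hu.memLp_weakDeriv hΩ (by rw [sum_single_eq]; omega))
  · refine (hu.isWeakDeriv (α := Pi.single j 2) (by rw [sum_single_eq]; omega)).of_add
      (hu.isWeakDeriv ?_)
    simp only [Pi.add_apply, Finset.sum_add_distrib, sum_single_eq]
    omega

theorem MemSobolev.memLp_sum_weakDeriv (hΩ : IsOpen Ω) {γ : Fin d → ℕ}
    (hu : MemSobolev Ω m p u) (hγ : 2 + ∑ i, γ i ≤ m) :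
    MemLp (fun x => ∑ j, weakDeriv Ω (Pi.single j 2 + γ) u x) (ENNReal.ofReal p)
      (volume.restrict Ω) := by
  refine memLp_finsetSum _ fun j _ => hu.memLp_weakDeriv hΩ ?_
  simp only [Pi.add_apply, Finset.sum_add_distrib, sum_single_eq]
  omega

theorem MemSobolev.memSobolev_weakLaplacian (hΩ : IsOpen Ω) (hp : 1 ≤ p)
    (hu : MemSobolev Ω (2 + m) p u) : MemSobolev Ω m p (weakLaplacian Ω u) := by
  refine ⟨?_, fun γ hγ => ⟨_, hu.memLp_sum_weakDeriv hΩ (γ := γ) (by omega),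
    hu.isWeakDeriv_weakLaplacian hΩ hp (by omega)⟩⟩
  have := hu.memLp_sum_weakDeriv hΩ (γ := 0) (by simp)
  simp only [add_zero] at this
  exact this

/-- The factor `d` counts the terms `∂_j² ∂^γ u`, each bounded by the full norm. Taking `m = 2` with
`γ = 0`, and `m = 3` with `|γ| ≤ 1`, produces the two norms of the final estimate. -/
theorem MemSobolev.lpNorm_weakDeriv_weakLaplacian_le (hΩ : IsOpen Ω) (hp : 1 ≤ p)
    {γ : Fin d → ℕ} (hu : MemSobolev Ω m p u) (hγ : 2 + ∑ i, γ i ≤ m) :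
    lpNorm (weakDeriv Ω γ (weakLaplacian Ω u)) (ENNReal.ofReal p) (volume.restrict Ω) ≤
      d * sobolevNorm Ω m p u := by
  have hle : ∀ j : Fin d, ∑ i, (Pi.single j 2 + γ : Fin d → ℕ) i ≤ m := fun j => by
    simp only [Pi.add_apply, Finset.sum_add_distrib, sum_single_eq]
    omega
  rw [lpNorm_congr ((hu.isWeakDeriv_weakLaplacian hΩ hp hγ).weakDeriv_ae_eq hΩ)]
  have h := lpNorm_sum_le (s := Finset.univ) (f := fun j => weakDeriv Ω (Pi.single j 2 + γ) u)
    (fun j _ => hu.memLp_weakDeriv hΩ (hle j)) (one_le_ofReal hp)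
  rw [Finset.sum_fn] at h
  refine h.trans ((Finset.sum_le_sum fun j _ => hu.lpNorm_weakDeriv_le hΩ hp (hle j)).trans ?_)
  simp

end Sobolev

/-! ### The one-dimensional inequality -/

section OneDim

variable {p : ℝ} {h : ℝ → ℂ}

theorem continuous_norm_rpow_mul_norm_deriv (hp : 1 ≤ p) (hh : ContDiff ℝ 1 h) :
    Continuous fun t => p * (‖h t‖ ^ (p - 1) * ‖deriv h t‖) :=
  continuous_const.mul ((hh.continuous.norm.rpow_const fun _ => Or.inr (by linarith)).mul
    (hh.continuous_deriv (by simp)).norm)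

theorem norm_rpow_le_add_integral (hp : 1 ≤ p) (hh : ContDiff ℝ 1 h) {t : ℝ} (ht : 0 ≤ t) :
    ‖h 0‖ ^ p ≤ ‖h t‖ ^ p + ∫ s in (0 : ℝ)..t, p * (‖h s‖ ^ (p - 1) * ‖deriv h s‖) := by
  have hcont := continuous_norm_rpow_mul_norm_deriv hp hh
  -- For `p = 1` the function `|h|` may fail to be differentiable at zeros of `h`, so the
  -- fundamental theorem is applied to `h` itself. For `p > 1` it is applied to `|h|^p`, which is
  -- `C¹`.
  rcases hp.eq_or_lt with rfl | hp1
  · have e : ∫ s in (0 : ℝ)..t, deriv h s = h t - h 0 :=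
      intervalIntegral.integral_deriv_eq_sub
        (fun x _ => (hh.differentiable (by simp)) x)
        ((hh.continuous_deriv (by simp)).intervalIntegrable _ _)
    have e2 : ‖∫ s in (0 : ℝ)..t, deriv h s‖ ≤ ∫ s in (0 : ℝ)..t, ‖deriv h s‖ :=
      intervalIntegral.norm_integral_le_integral_norm ht
    have e3 : h 0 = h t - ∫ s in (0 : ℝ)..t, deriv h s := by rw [e]; ring
    simp only [Real.rpow_one, sub_self, Real.rpow_zero, one_mul]
    calc ‖h 0‖ ≤ ‖h t‖ + ‖∫ s in (0 : ℝ)..t, deriv h s‖ := by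
          rw [e3]; exact norm_sub_le _ _
      _ ≤ _ := by gcongr
  · set N : ℝ → ℝ := fun t => ‖h t‖ ^ p with hN
    have hNc : ContDiff ℝ 1 N := (contDiff_norm_rpow hp1).comp hh
    have hder : ∀ s, ‖deriv N s‖ ≤ p * (‖h s‖ ^ (p - 1) * ‖deriv h s‖) := by
      intro s
      have h1 : HasDerivAt h (deriv h s) s := ((hh.differentiable (by simp)) s).hasDerivAt
      have h2 := (hasFDerivAt_norm_rpow (h s) hp1).comp_hasDerivAt s h1
      have h3 : deriv N s = _ := h2.deriv
      rw [h3, smul_apply, innerSL_apply_apply, norm_smul, norm_mul,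
        Real.norm_of_nonneg (by linarith : 0 ≤ p),
        Real.norm_of_nonneg (Real.rpow_nonneg (norm_nonneg _) _), mul_assoc]
      refine mul_le_mul_of_nonneg_left ?_ (by linarith)
      rcases eq_or_ne (h s) 0 with h0 | h0
      · rw [h0, inner_zero_left, norm_zero]
        simp only [norm_zero, mul_zero]
        positivity
      · have hpos : 0 < ‖h s‖ := norm_pos_iff.2 h0
        have : ‖h s‖ ^ (p - 1) = ‖h s‖ ^ (p - 2) * ‖h s‖ := by
          rw [← Real.rpow_add_one hpos.ne']; ring_nf
        rw [this, mul_assoc]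
        exact mul_le_mul_of_nonneg_left (norm_inner_le_norm _ _) (by positivity)
    have e : ∫ s in (0 : ℝ)..t, deriv N s = N t - N 0 :=
      intervalIntegral.integral_deriv_eq_sub
        (fun x _ => (hNc.differentiable (by simp)) x)
        ((hNc.continuous_deriv (by simp)).intervalIntegrable _ _)
    have e2 : ‖∫ s in (0 : ℝ)..t, deriv N s‖ ≤
        ∫ s in (0 : ℝ)..t, p * (‖h s‖ ^ (p - 1) * ‖deriv h s‖) :=
      intervalIntegral.norm_integral_le_of_norm_le ht (ae_of_all _ fun s _ => hder s)
        (hcont.intervalIntegrable _ _)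
    rw [e] at e2
    have := (abs_le.1 e2).1
    change N 0 ≤ N t + _
    linarith

/-- The mean over `0 ≤ t ≤ b` of `norm_rpow_le_add_integral`, after its integral has been enlarged
to all of `[0, b]`. Averaging replaces a single interior value by an integral. -/
theorem norm_rpow_le_integral (hp : 1 ≤ p) (hh : ContDiff ℝ 1 h) {b : ℝ} (hb : 0 < b) :
    ‖h 0‖ ^ p ≤
      ∫ t in (0 : ℝ)..b, (b⁻¹ * ‖h t‖ ^ p + p * (‖h t‖ ^ (p - 1) * ‖deriv h t‖)) := by
  have hcont := continuous_norm_rpow_mul_norm_deriv hp hh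
  have hc2 : Continuous fun t => ‖h t‖ ^ p :=
    hh.continuous.norm.rpow_const fun _ => Or.inr (by linarith)
  set J := ∫ s in (0 : ℝ)..b, p * (‖h s‖ ^ (p - 1) * ‖deriv h s‖) with hJ
  have h1 : ∀ t ∈ Set.Icc 0 b, ‖h 0‖ ^ p ≤ ‖h t‖ ^ p + J := by
    intro t ht
    refine (norm_rpow_le_add_integral hp hh ht.1).trans ?_
    gcongr
    refine intervalIntegral.integral_mono_interval le_rfl ht.1 ht.2 ?_
      (hcont.intervalIntegrable _ _)
    exact ae_of_all _ fun s => by dsimp; positivity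
  have h2 : ∫ _ in (0 : ℝ)..b, ‖h 0‖ ^ p ≤ ∫ t in (0 : ℝ)..b, (‖h t‖ ^ p + J) :=
    intervalIntegral.integral_mono_on hb.le (by simp)
      ((hc2.add continuous_const).intervalIntegrable _ _) h1
  rw [intervalIntegral.integral_add (hc2.intervalIntegrable _ _) (by simp)] at h2
  simp only [intervalIntegral.integral_const, sub_zero, smul_eq_mul] at h2
  rw [intervalIntegral.integral_add ((hc2.intervalIntegrable _ _).const_mul _)
    (hcont.intervalIntegrable _ _), intervalIntegral.integral_const_mul, ← hJ]
  calc ‖h 0‖ ^ p = b⁻¹ * (b * ‖h 0‖ ^ p) := by field_simp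
    _ ≤ b⁻¹ * ((∫ t in (0 : ℝ)..b, ‖h t‖ ^ p) + b * J) := by gcongr
    _ = _ := by field_simp

end OneDim

/-! ### The charts -/

section Charts

variable {n : ℕ}

@[simp] theorem headCoord_joinCoord (x' : E n) (t : ℝ) : headCoord (joinCoord x' t) = x' := by
  ext i; simp [headCoord, joinCoord]

@[simp] theorem lastCoord_joinCoord (x' : E n) (t : ℝ) : lastCoord (joinCoord x' t) = t := by
  simp [lastCoord, joinCoord]

theorem joinCoord_headCoord_lastCoord (x : E (n + 1)) :
    joinCoord (headCoord x) (lastCoord x) = x := by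
  ext i
  refine Fin.lastCases ?_ (fun j => ?_) i
  · simp [lastCoord, joinCoord]
  · simp [headCoord, joinCoord]

theorem joinCoord_add (x' : E n) (s t : ℝ) :
    joinCoord x' (s + t) = joinCoord x' s + t • EuclideanSpace.single (Fin.last n) 1 := by
  ext i
  refine Fin.lastCases ?_ (fun j => ?_) i
  · simp [joinCoord]
  · simp [joinCoord, Fin.castSucc_ne_last]

theorem continuous_headCoord : Continuous (headCoord : E (n + 1) → E n) := by
  unfold headCoord; fun_prop

theorem continuous_lastCoord : Continuous (lastCoord : E (n + 1) → ℝ) := by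
  unfold lastCoord; fun_prop

theorem continuous_joinCoord : Continuous fun q : E n × ℝ => joinCoord q.1 q.2 := by
  unfold joinCoord
  refine (PiLp.continuous_toLp 2 _).comp (continuous_pi fun i => ?_)
  refine Fin.lastCases ?_ (fun j => ?_) i
  · simpa using continuous_snd
  · simp only [Fin.snoc_castSucc]; fun_prop

/-- The map is factored into steps known to preserve volume: pass to plain coordinate vectors, swap,
insert the last coordinate, return to Euclidean space. -/
theorem measurePreserving_joinCoord :
    MeasurePreserving (fun q : E n × ℝ => joinCoord q.1 q.2) volume volume := by
  have h1 : MeasurePreserving (Prod.map (MeasurableEquiv.toLp 2 (Fin n → ℝ)).symm (id : ℝ → ℝ))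
      (volume : Measure (E n × ℝ)) volume :=
    (EuclideanSpace.volume_preserving_symm_measurableEquiv_toLp (Fin n)).prod
      (MeasurePreserving.id (volume : Measure ℝ))
  have h2 : MeasurePreserving (Prod.swap : (Fin n → ℝ) × ℝ → ℝ × (Fin n → ℝ)) volume volume :=
    Measure.measurePreserving_swap
  have h3 := (volume_preserving_piFinSuccAbove (fun _ : Fin (n + 1) => ℝ) (Fin.last n)).symm
  have h4 := (EuclideanSpace.volume_preserving_symm_measurableEquiv_toLp (Fin (n + 1))).symm
  have h := h4.comp (h3.comp (h2.comp h1))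
  have e : (fun q : E n × ℝ => joinCoord q.1 q.2) =
      (MeasurableEquiv.toLp 2 (Fin (n + 1) → ℝ)).symm.symm ∘
      (MeasurableEquiv.piFinSuccAbove (fun _ : Fin (n + 1) => ℝ) (Fin.last n)).symm ∘
      Prod.swap ∘ Prod.map (MeasurableEquiv.toLp 2 (Fin n → ℝ)).symm (id : ℝ → ℝ) := by
    funext q
    ext i
    refine Fin.lastCases ?_ (fun j => ?_) i
    · simp [joinCoord, MeasurableEquiv.piFinSuccAbove]
    · simp [joinCoord, MeasurableEquiv.piFinSuccAbove]
  rw [e]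
  exact h

theorem isOpen_openCube (a : ℝ) : IsOpen (openCube n a) := by
  have : openCube n a = ⋂ j, {x' : E n | |x' j| < a} := by
    ext x; simp [openCube]
  rw [this]
  exact isOpen_iInter_of_finite fun j => isOpen_lt (by fun_prop) continuous_const

theorem openCube_subset_closedCube (a : ℝ) : openCube n a ⊆ closedCube n a :=
  fun _ hx j => (hx j).le

namespace LocalGraphSystem

variable {Ω : Set (E (n + 1))} (S : LocalGraphSystem Ω) (r : Fin S.m)

/-- The unit vector of the last axis of the `r`-th coordinate system. -/
def inward : E (n + 1) :=
  (S.coord r).symm.linearIsometryEquiv (EuclideanSpace.single (Fin.last n) 1)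

theorem norm_inward : ‖S.inward r‖ = 1 := by simp [inward]

theorem coord_symm_joinCoord_add (x' : E n) (s t : ℝ) :
    (S.coord r).symm (joinCoord x' (s + t)) =
      (S.coord r).symm (joinCoord x' s) + t • S.inward r := by
  have h := (S.coord r).symm.map_vadd (joinCoord x' s)
    (t • EuclideanSpace.single (Fin.last n) (1 : ℝ))
  rw [vadd_eq_add, vadd_eq_add, map_smul] at h
  rw [joinCoord_add, add_comm (joinCoord x' s), h, add_comm (_ • _)]
  rfl

theorem coord_add_smul_inward (x : E (n + 1)) (t : ℝ) :
    S.coord r (x + t • S.inward r) =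
      joinCoord (headCoord (S.coord r x)) (lastCoord (S.coord r x) + t) := by
  rw [← (S.coord r).symm.injective.eq_iff, coord_symm_joinCoord_add,
    joinCoord_headCoord_lastCoord]
  simp

theorem continuousOn_boundaryPoint : ContinuousOn (S.boundaryPoint r) (openCube n S.a) := by
  unfold boundaryPoint
  refine (S.coord r).symm.continuous.comp_continuousOn
    (continuous_joinCoord.comp_continuousOn (continuousOn_id.prodMk ?_))
  exact (S.continuousOn_graph r).mono (openCube_subset_closedCube _)

theorem boundaryPoint_mem_frontier {x' : E n} (hx : x' ∈ openCube n S.a) :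
    S.boundaryPoint r x' ∈ frontier Ω := by
  have : S.boundaryPoint r x' ∈ S.V r ∩ frontier Ω := by
    rw [S.V_inter_frontier r]
    simp [boundaryPoint, hx]
  exact this.2

theorem boundaryPoint_add_mem {x' : E n} (hx : x' ∈ openCube n S.a) {t : ℝ} (h0 : 0 < t)
    (hb : t < S.b) : S.boundaryPoint r x' + t • S.inward r ∈ Ω := by
  have : S.boundaryPoint r x' + t • S.inward r ∈ S.V r ∩ Ω := by
    rw [S.V_inter_domain r]
    simp [coord_add_smul_inward, boundaryPoint, hx, h0, hb]
  exact this.2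

/-- The part of `Ω` in a chart, swept out by the translates of the boundary piece. -/
theorem lintegral_boundaryPoint_add_le (hΩ : MeasurableSet Ω) {G : E (n + 1) → ℝ≥0∞}
    (hG : Measurable G) :
    ∫⁻ x' in openCube n S.a, ∫⁻ t in Set.Ioo 0 S.b,
      G (S.boundaryPoint r x' + t • S.inward r) ≤ ∫⁻ x in Ω, G x := by
  set F := Ω.indicator G with hF
  have hFm : Measurable F := hG.indicator hΩ
  -- An affine isometry is a linear isometry followed by a translation.
  have hcm : MeasurePreserving (S.coord r).symm (volume : Measure (E (n + 1))) volume := by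
    have hl := (S.coord r).symm.linearIsometryEquiv.measurePreserving
    have ha := measurePreserving_add_right (volume : Measure (E (n + 1))) ((S.coord r).symm 0)
    have e : ⇑(S.coord r).symm =
        (fun x => x + (S.coord r).symm 0) ∘ (S.coord r).symm.linearIsometryEquiv := by
      funext x
      simpa using (S.coord r).symm.map_vadd 0 x
    rw [e]
    exact ha.comp hl
  have hmp := hcm.comp (measurePreserving_joinCoord (n := n))
  calc ∫⁻ x' in openCube n S.a, ∫⁻ t in Set.Ioo 0 S.b,
        G (S.boundaryPoint r x' + t • S.inward r)
      ≤ ∫⁻ x' in openCube n S.a, ∫⁻ t, F ((S.coord r).symm (joinCoord x' t)) := by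
        refine setLIntegral_mono' (isOpen_openCube _).measurableSet fun x' hx' => ?_
        -- For fixed `x'`, straightening the graph is a translation in `t`, so no Jacobian appears.
        rw [← lintegral_add_left_eq_self (μ := (volume : Measure ℝ)) _ (S.graph r x'),
          ← lintegral_indicator measurableSet_Ioo]
        refine lintegral_mono fun t => ?_
        by_cases ht : t ∈ Set.Ioo 0 S.b
        · rw [Set.indicator_of_mem ht, coord_symm_joinCoord_add, hF]
          change _ ≤ Ω.indicator G (S.boundaryPoint r x' + t • S.inward r)
          rw [Set.indicator_of_mem (S.boundaryPoint_add_mem r hx' ht.1 ht.2)]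
        · rw [Set.indicator_of_notMem ht]
          exact zero_le
    _ ≤ ∫⁻ x', ∫⁻ t, F ((S.coord r).symm (joinCoord x' t)) := setLIntegral_le_lintegral _ _
    _ = ∫⁻ q : E n × ℝ, F ((S.coord r).symm (joinCoord q.1 q.2)) := by
        rw [Measure.volume_eq_prod, lintegral_prod]
        exact (hFm.comp hmp.measurable).aemeasurable
    _ = ∫⁻ x, F x := hmp.lintegral_comp hFm
    _ = ∫⁻ x in Ω, G x := by rw [hF, lintegral_indicator hΩ]

end LocalGraphSystem

end Charts

/-! ### The trace inequality for smooth functions -/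

section TraceInequality

variable {n : ℕ} {Ω : Set (E (n + 1))} {p : ℝ}

theorem memLp_of_continuous {d : ℕ} {Ω : Set (E d)} (hbdd : Bornology.IsBounded Ω)
    {F : Type*} [NormedAddCommGroup F] {f : E d → F} (hf : Continuous f) (q : ℝ≥0∞) :
    MemLp f q (volume.restrict Ω) := by
  have : IsFiniteMeasure (volume.restrict Ω) := ⟨by
    rw [Measure.restrict_apply_univ]; exact hbdd.measure_lt_top⟩
  obtain ⟨C, hC⟩ := hbdd.isCompact_closure.exists_bound_of_continuousOn hf.continuousOn
  have h : ∀ᵐ x ∂(volume.restrict (closure Ω)), ‖f x‖ ≤ C :=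
    ae_restrict_of_forall_mem isClosed_closure.measurableSet hC
  exact MemLp.of_bound hf.aestronglyMeasurable C
    (ae_restrict_of_ae_restrict_of_subset subset_closure h)

/-- The sum of the absolute values of the partial derivatives. -/
def gradSum {d : ℕ} (φ : E d → ℂ) (x : E d) : ℝ :=
  ∑ i, ‖fderiv ℝ φ x (EuclideanSpace.single i 1)‖

theorem continuous_fderiv_single {d : ℕ} {φ : E d → ℂ} (hφ : ContDiff ℝ 1 φ) (i : Fin d) :
    Continuous fun x => fderiv ℝ φ x (EuclideanSpace.single i 1) :=
  (hφ.continuous_fderiv (by simp)).clm_apply continuous_const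

theorem continuous_gradSum {d : ℕ} {φ : E d → ℂ} (hφ : ContDiff ℝ 1 φ) :
    Continuous (gradSum φ) :=
  continuous_finsetSum _ fun i _ => (continuous_fderiv_single hφ i).norm

theorem gradSum_nonneg {d : ℕ} (φ : E d → ℂ) (x : E d) : 0 ≤ gradSum φ x :=
  Finset.sum_nonneg fun _ _ => norm_nonneg _

/-- Controls the derivative along the inward axis of any chart by derivatives in the fixed
coordinates in which Sobolev norms are measured. -/
theorem norm_fderiv_apply_le_gradSum {d : ℕ} (φ : E d → ℂ) (x v : E d) :
    ‖fderiv ℝ φ x v‖ ≤ ‖v‖ * gradSum φ x := by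
  have hv : v = ∑ i, v i • EuclideanSpace.single i (1 : ℝ) := by
    ext j
    simp [Pi.single_apply]
  conv_lhs => rw [hv, map_sum]
  refine (norm_sum_le _ _).trans ?_
  rw [gradSum, Finset.mul_sum]
  refine Finset.sum_le_sum fun i _ => ?_
  rw [map_smul, norm_smul]
  gcongr
  exact PiLp.norm_apply_le v i

theorem lpNorm_gradSum_le {d : ℕ} {Ω : Set (E d)} (hbdd : Bornology.IsBounded Ω) (hp : 1 ≤ p)
    {φ : E d → ℂ} (hφ : ContDiff ℝ 1 φ) :
    lpNorm (gradSum φ) (ENNReal.ofReal p) (volume.restrict Ω) ≤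
      ∑ i, lpNorm (fun x => fderiv ℝ φ x (EuclideanSpace.single i 1)) (ENNReal.ofReal p)
        (volume.restrict Ω) := by
  have h := lpNorm_sum_le (μ := volume.restrict Ω) (p := ENNReal.ofReal p) (s := Finset.univ)
    (f := fun (i : Fin d) x => ‖fderiv ℝ φ x (EuclideanSpace.single i 1)‖)
    (fun i _ => memLp_of_continuous hbdd (continuous_fderiv_single hφ i).norm _)
    (one_le_ofReal hp)
  rw [Finset.sum_fn] at h
  refine h.trans (Finset.sum_le_sum fun i _ => le_of_eq ?_)
  exact lpNorm_norm (continuous_fderiv_single hφ i).aestronglyMeasurable _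

/-- Hölder's inequality with exponents `p / (p - 1)` and `p`. At `p = 1` the first factor is
constant and the claim is an equality. -/
theorem integral_norm_rpow_mul_le {X F : Type*} [MeasurableSpace X] [NormedAddCommGroup F]
    {μ : Measure X} (hp : 1 ≤ p) {f : X → F} {g : X → ℝ} (hf : MemLp f (ENNReal.ofReal p) μ)
    (hg : MemLp g (ENNReal.ofReal p) μ) (hg0 : ∀ x, 0 ≤ g x) :
    ∫ x, ‖f x‖ ^ (p - 1) * g x ∂μ ≤
      lpNorm f (ENNReal.ofReal p) μ ^ (p - 1) * lpNorm g (ENNReal.ofReal p) μ := by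
  rcases hp.eq_or_lt with rfl | hp1
  · have := lpNorm_rpow_eq le_rfl hg.1
    simp only [sub_self, Real.rpow_zero, one_mul]
    simp only [Real.rpow_one] at this
    rw [this]
    exact le_of_eq (integral_congr_ae (ae_of_all _ fun x => (Real.norm_of_nonneg (hg0 x)).symm))
  · have hpq : p.HolderConjugate (p / (p - 1)) := Real.HolderConjugate.conjExponent hp1
    have hp0 : 0 < p := by linarith
    have hp1' : 0 < p - 1 := by linarith
    have hmul : (p - 1) * (p / (p - 1)) = p := by field_simp
    have hfm : MemLp (fun x => ‖f x‖ ^ (p - 1)) (ENNReal.ofReal (p / (p - 1))) μ := by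
      have := hf.norm_rpow_div (ENNReal.ofReal (p - 1))
      rwa [ENNReal.toReal_ofReal hp1'.le, ← ENNReal.ofReal_div_of_pos hp1'] at this
    have h := integral_mul_le_Lp_mul_Lq_of_nonneg hpq.symm
      (f := fun x => ‖f x‖ ^ (p - 1)) (g := g) (μ := μ)
      (ae_of_all _ fun x => Real.rpow_nonneg (norm_nonneg _) _) (ae_of_all _ hg0) hfm hg
    refine h.trans (le_of_eq ?_)
    have e1 : ∫ x, (‖f x‖ ^ (p - 1)) ^ (p / (p - 1)) ∂μ =
        lpNorm f (ENNReal.ofReal p) μ ^ p := by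
      rw [lpNorm_rpow_eq hp hf.1]
      refine integral_congr_ae (ae_of_all _ fun x => ?_)
      dsimp only
      rw [← Real.rpow_mul (norm_nonneg _), hmul]
    have e2 : ∫ x, g x ^ p ∂μ = lpNorm g (ENNReal.ofReal p) μ ^ p := by
      rw [lpNorm_rpow_eq hp hg.1]
      refine integral_congr_ae (ae_of_all _ fun x => ?_)
      dsimp only
      rw [Real.norm_of_nonneg (hg0 x)]
    rw [e1, e2, ← Real.rpow_mul lpNorm_nonneg, ← Real.rpow_mul lpNorm_nonneg]
    congr 1
    · congr 1; field_simp
    · rw [mul_one_div_cancel hp0.ne', Real.rpow_one]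

variable (S : LocalGraphSystem Ω)

/-- The one-dimensional inequality on each inward segment, integrated over the cube. The integration
is done with `∫⁻`, so integrability on almost every segment is never an issue. -/
theorem integral_boundaryPoint_le (hΩ : IsOpen Ω) (hbdd : Bornology.IsBounded Ω) (hp : 1 ≤ p)
    (r : Fin S.m) {φ : E (n + 1) → ℂ} (hφ : ContDiff ℝ 1 φ) :
    ∫ x' in openCube n S.a, ‖φ (S.boundaryPoint r x')‖ ^ p ≤
      ∫ x in Ω, (S.b⁻¹ * ‖φ x‖ ^ p + p * (‖φ x‖ ^ (p - 1) * gradSum φ x)) := by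
  set H : E (n + 1) → ℝ := fun x => S.b⁻¹ * ‖φ x‖ ^ p + p * (‖φ x‖ ^ (p - 1) * gradSum φ x)
    with hH
  have hb := S.b_pos
  have hHc : Continuous H :=
    (continuous_const.mul (hφ.continuous.norm.rpow_const fun _ => Or.inr (by linarith))).add
      (continuous_const.mul ((hφ.continuous.norm.rpow_const fun _ => Or.inr (by linarith)).mul
        (continuous_gradSum hφ)))
  have hH0 : ∀ x, 0 ≤ H x := fun x => by
    have := gradSum_nonneg φ x
    simp only [hH]; positivity
  have hHi : Integrable H (volume.restrict Ω) :=
    memLp_one_iff_integrable.1 (memLp_of_continuous hbdd hHc 1)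
  have hpt : ∀ x' ∈ openCube n S.a, ENNReal.ofReal (‖φ (S.boundaryPoint r x')‖ ^ p) ≤
      ∫⁻ t in Set.Ioo 0 S.b, ENNReal.ofReal (H (S.boundaryPoint r x' + t • S.inward r)) := by
    intro x' _
    set h : ℝ → ℂ := fun t => φ (S.boundaryPoint r x' + t • S.inward r) with hh
    have hl : ContDiff ℝ 1 fun t : ℝ => S.boundaryPoint r x' + t • S.inward r := by fun_prop
    have hhc : ContDiff ℝ 1 h := hφ.comp hl
    have hd : ∀ t, ‖deriv h t‖ ≤ gradSum φ (S.boundaryPoint r x' + t • S.inward r) := by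
      intro t
      have h1 : HasDerivAt (fun t : ℝ => S.boundaryPoint r x' + t • S.inward r)
          (S.inward r) t := by
        simpa using ((hasDerivAt_id t).smul_const (S.inward r)).const_add (S.boundaryPoint r x')
      have h2 := ((hφ.differentiable (by simp)) _).hasFDerivAt.comp_hasDerivAt t h1
      have h3 : deriv h t = _ := h2.deriv
      rw [h3]
      simpa [S.norm_inward r] using norm_fderiv_apply_le_gradSum φ
        (S.boundaryPoint r x' + t • S.inward r) (S.inward r)
    have hHl : Continuous fun t : ℝ => H (S.boundaryPoint r x' + t • S.inward r) :=
      hHc.comp hl.continuous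
    have key : ‖φ (S.boundaryPoint r x')‖ ^ p ≤
        ∫ t in (0 : ℝ)..S.b, H (S.boundaryPoint r x' + t • S.inward r) := by
      have h0 := norm_rpow_le_integral hp hhc hb
      have hz : h 0 = φ (S.boundaryPoint r x') := by simp [hh]
      rw [hz] at h0
      refine h0.trans (intervalIntegral.integral_mono_on hb.le ?_
        (hHl.intervalIntegrable _ _) fun t _ => ?_)
      · exact ((continuous_const.mul (hhc.continuous.norm.rpow_const
          fun _ => Or.inr (by linarith))).add
            (continuous_norm_rpow_mul_norm_deriv hp hhc)).intervalIntegrable _ _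
      · have := hd t
        simp only [hH]
        gcongr
    rw [intervalIntegral.integral_of_le hb.le, integral_Ioc_eq_integral_Ioo] at key
    refine (ENNReal.ofReal_le_ofReal key).trans (le_of_eq ?_)
    refine ofReal_integral_eq_lintegral_ofReal ?_ (ae_of_all _ fun t => hH0 _)
    exact (hHl.integrableOn_Icc (a := 0) (b := S.b)).mono_set Set.Ioo_subset_Icc_self
  have hle : ∫⁻ x' in openCube n S.a, ENNReal.ofReal (‖φ (S.boundaryPoint r x')‖ ^ p) ≤
      ENNReal.ofReal (∫ x in Ω, H x) := by
    rw [ofReal_integral_eq_lintegral_ofReal hHi (ae_of_all _ hH0)]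
    refine (setLIntegral_mono' (isOpen_openCube _).measurableSet hpt).trans ?_
    exact S.lintegral_boundaryPoint_add_le r hΩ.measurableSet
      (ENNReal.measurable_ofReal.comp hHc.measurable)
  rw [integral_eq_lintegral_of_nonneg_ae (ae_of_all _ fun x' => by dsimp; positivity)]
  · exact ENNReal.toReal_le_of_le_ofReal (integral_nonneg hH0) hle
  · refine ContinuousOn.aestronglyMeasurable ?_ (isOpen_openCube _).measurableSet
    exact (hφ.continuous.comp_continuousOn (S.continuousOn_boundaryPoint r)).norm.rpow_const
      fun _ _ => Or.inr (by linarith)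

/-- The multiplicative trace inequality for functions that are `C¹` up to the boundary. -/
theorem exists_boundaryNorm_le (hΩ : IsOpen Ω) (hbdd : Bornology.IsBounded Ω) (hp : 1 ≤ p) :
    ∃ C : ℝ, 0 < C ∧ ∀ φ : E (n + 1) → ℂ, ContDiff ℝ 1 φ →
      boundaryNorm S p φ ≤
        C * lpNorm φ (ENNReal.ofReal p) (volume.restrict Ω) ^ ((p - 1) / p) *
          (lpNorm φ (ENNReal.ofReal p) (volume.restrict Ω) +
            ∑ i, lpNorm (fun x => fderiv ℝ φ x (EuclideanSpace.single i 1)) (ENNReal.ofReal p)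
              (volume.restrict Ω)) ^ (1 / p) := by
  have hb := S.b_pos
  have hp0 : 0 < p := by linarith
  -- One factor counts charts, the other collects the coefficients of the one-dimensional
  -- inequality. Writing `S.m + 1` keeps `K` positive without showing that a chart exists.
  set K : ℝ := (S.m + 1) * (S.b⁻¹ + p) with hK
  have hK0 : 0 < K := by positivity
  refine ⟨K ^ (1 / p), by positivity, fun φ hφ => ?_⟩
  set A := lpNorm φ (ENNReal.ofReal p) (volume.restrict Ω) with hA
  set D := ∑ i, lpNorm (fun x => fderiv ℝ φ x (EuclideanSpace.single i 1)) (ENNReal.ofReal p)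
    (volume.restrict Ω) with hD
  have hA0 : 0 ≤ A := lpNorm_nonneg
  have hD0 : 0 ≤ D := Finset.sum_nonneg fun _ _ => lpNorm_nonneg
  have hφm := memLp_of_continuous hbdd hφ.continuous (ENNReal.ofReal p)
  have hgm := memLp_of_continuous hbdd (continuous_gradSum hφ) (ENNReal.ofReal p)
  have hint : ∫ x in Ω, (S.b⁻¹ * ‖φ x‖ ^ p + p * (‖φ x‖ ^ (p - 1) * gradSum φ x)) ≤
      (S.b⁻¹ + p) * (A ^ (p - 1) * (A + D)) := by
    have hc1 : Continuous fun x => ‖φ x‖ ^ p :=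
      hφ.continuous.norm.rpow_const fun _ => Or.inr (by linarith)
    have hc2 : Continuous fun x => ‖φ x‖ ^ (p - 1) * gradSum φ x :=
      (hφ.continuous.norm.rpow_const fun _ => Or.inr (by linarith)).mul (continuous_gradSum hφ)
    rw [integral_add
      (memLp_one_iff_integrable.1 (memLp_of_continuous hbdd hc1 1) |>.const_mul _)
      (memLp_one_iff_integrable.1 (memLp_of_continuous hbdd hc2 1) |>.const_mul _),
      integral_const_mul, integral_const_mul, ← lpNorm_rpow_eq hp hφm.1, ← hA]
    have h1 : ∫ x in Ω, ‖φ x‖ ^ (p - 1) * gradSum φ x ≤ A ^ (p - 1) * D :=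
      (integral_norm_rpow_mul_le hp hφm hgm (gradSum_nonneg φ)).trans
        (mul_le_mul_of_nonneg_left (lpNorm_gradSum_le hbdd hp hφ) (by positivity))
    have h2 : A ^ p = A ^ (p - 1) * A := by
      rw [← Real.rpow_add_one' hA0 (by linarith)]; ring_nf
    have h3 : 0 ≤ A ^ (p - 1) := by positivity
    have hb' : 0 < S.b⁻¹ := by positivity
    rw [h2]
    calc _ ≤ S.b⁻¹ * (A ^ (p - 1) * A) + p * (A ^ (p - 1) * D) := by gcongr
      _ ≤ S.b⁻¹ * (A ^ (p - 1) * (A + D)) + p * (A ^ (p - 1) * (A + D)) := by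
          gcongr <;> linarith
      _ = _ := by ring
  have hsum : ∑ r, ∫ x' in openCube n S.a, ‖φ (S.boundaryPoint r x')‖ ^ p ≤
      K * (A ^ (p - 1) * (A + D)) := by
    calc _ ≤ ∑ _r : Fin S.m, (S.b⁻¹ + p) * (A ^ (p - 1) * (A + D)) :=
          Finset.sum_le_sum fun r _ => (integral_boundaryPoint_le S hΩ hbdd hp r hφ).trans hint
      _ = S.m * ((S.b⁻¹ + p) * (A ^ (p - 1) * (A + D))) := by simp
      _ ≤ (S.m + 1) * ((S.b⁻¹ + p) * (A ^ (p - 1) * (A + D))) := by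
          gcongr; linarith
      _ = _ := by rw [hK]; ring
  unfold boundaryNorm
  refine (Real.rpow_le_rpow (Finset.sum_nonneg fun _ _ => integral_nonneg fun _ => by positivity)
    hsum (by positivity)).trans (le_of_eq ?_)
  rw [Real.mul_rpow hK0.le (by positivity),
    Real.mul_rpow (x := A ^ (p - 1)) (by positivity) (by positivity),
    ← Real.rpow_mul hA0, mul_one_div, mul_assoc]

end TraceInequality

/-! ### Mollification in `L^p` -/

section Mollify

/-- Jensen's inequality for the probability measure `ρ dμ`, obtained from monotonicity of `L^p`
norms in the exponent. -/
theorem rpow_lintegral_mul_le {X : Type*} [MeasurableSpace X] {μ : Measure X} {p : ℝ}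
    (hp : 1 ≤ p) {ρ F : X → ℝ≥0∞} (hρ : AEMeasurable ρ μ) (hρ1 : ∫⁻ x, ρ x ∂μ = 1)
    (hF : AEMeasurable F μ) : (∫⁻ x, ρ x * F x ∂μ) ^ p ≤ ∫⁻ x, ρ x * F x ^ p ∂μ := by
  have hprob : IsProbabilityMeasure (μ.withDensity ρ) :=
    ⟨by rw [withDensity_apply _ MeasurableSet.univ, Measure.restrict_univ, hρ1]⟩
  have hFd : AEMeasurable F (μ.withDensity ρ) :=
    hF.mono_ac (withDensity_absolutelyContinuous μ ρ)
  have h := eLpNorm'_le_eLpNorm'_of_exponent_le one_pos hp (μ.withDensity ρ)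
    hFd.aestronglyMeasurable
  simp only [eLpNorm', enorm_eq_self, ENNReal.rpow_one, div_one] at h
  rw [lintegral_withDensity_eq_lintegral_mul₀ hρ hF,
    lintegral_withDensity_eq_lintegral_mul₀ hρ (hF.pow_const p)] at h
  have h2 := ENNReal.rpow_le_rpow h (by linarith : 0 ≤ p)
  rwa [← ENNReal.rpow_mul, one_div_mul_cancel (by linarith), ENNReal.rpow_one] at h2

variable {d : ℕ} {p : ℝ}

/-- Continuity of translation in `L^p`, an instance of continuity of composition with
measure-preserving maps. -/
theorem tendsto_eLpNorm_translate (hp : 1 ≤ p) {w : E d → ℂ}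
    (hw : MemLp w (ENNReal.ofReal p) volume) :
    Tendsto (fun h : E d => eLpNorm (fun x => w (x - h) - w x) (ENNReal.ofReal p) volume)
      (𝓝 0) (𝓝 0) := by
  have : Fact (1 ≤ ENNReal.ofReal p) := ⟨one_le_ofReal hp⟩
  let g : E d → C(E d, E d) := fun h => ⟨fun x => x - h, by fun_prop⟩
  have hg : Continuous g := by
    apply ContinuousMap.continuous_of_continuous_uncurry
    exact (continuous_snd.sub continuous_fst : Continuous fun q : E d × E d => q.2 - q.1)
  have hgm : ∀ h, MeasurePreserving (g h) (volume : Measure (E d)) volume := fun h =>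
    measurePreserving_sub_right _ h
  have hc : Continuous fun h => Lp.compMeasurePreserving (g h) (hgm h) (hw.toLp w) :=
    continuous_const.compMeasurePreservingLp hg hgm (by simp)
  have ht := (hc.edist (continuous_const (y := hw.toLp w))).tendsto 0
  simp only [Lp.toLp_compMeasurePreserving, Lp.edist_toLp_toLp] at ht
  have h0 : w ∘ (g 0) - w = 0 := by
    funext x; simp [g]
  rw [h0, eLpNorm_zero] at ht
  exact ht

/-- The mollification error is a `ψ`-weighted mean of translation errors: Jensen at each `x`, then
Tonelli. The kernel need not be centred at `0`, which permits the displaced kernels used later. -/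
theorem eLpNorm_convolution_sub_le (hp : 1 ≤ p) {w : E d → ℂ}
    (hw : MemLp w (ENNReal.ofReal p) volume) {ψ : E d → ℝ} (hψ : Continuous ψ)
    (hψc : HasCompactSupport ψ) (hψ0 : ∀ x, 0 ≤ ψ x) (hψ1 : ∫ x, ψ x = 1) {c : ℝ≥0∞}
    (hc : ∀ t ∈ Function.support ψ,
      eLpNorm (fun x => w (x - t) - w x) (ENNReal.ofReal p) volume ≤ c) :
    eLpNorm (fun x => (∫ t, ψ t • w (x - t)) - w x) (ENNReal.ofReal p) volume ≤ c := by
  have hp0 : 0 < p := by linarith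
  have hpn : ENNReal.ofReal p ≠ 0 := by simpa using hp0
  have hψi : Integrable ψ := hψ.integrable_of_hasCompactSupport hψc
  have hρ1 : ∫⁻ t, ENNReal.ofReal (ψ t) = 1 := by
    rw [← ofReal_integral_eq_lintegral_ofReal hψi (ae_of_all _ hψ0), hψ1, ENNReal.ofReal_one]
  have hwl : LocallyIntegrable w := hw.locallyIntegrable (one_le_ofReal hp)
  have hconv : ∀ x, Integrable fun t => ψ t • w (x - t) := fun x =>
    hψc.convolutionExists_left (ContinuousLinearMap.lsmul ℝ ℝ) hψ hwl x
  have hsub : AEStronglyMeasurable (fun q : E d × E d => w (q.1 - q.2) - w q.1)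
      ((volume : Measure (E d)).prod volume) :=
    (hw.1.comp_quasiMeasurePreserving
      (quasiMeasurePreserving_sub_of_right_invariant volume volume)).sub
      (hw.1.comp_quasiMeasurePreserving Measure.quasiMeasurePreserving_fst)
  have hslice : ∀ x, AEMeasurable (fun t => ‖w (x - t) - w x‖ₑ) volume := fun x =>
    ((hw.1.comp_measurePreserving (Measure.measurePreserving_sub_left volume x)).sub
      aestronglyMeasurable_const).enorm
  have hpt : ∀ x, ‖(∫ t, ψ t • w (x - t)) - w x‖ₑ ^ p ≤
      ∫⁻ t, ENNReal.ofReal (ψ t) * ‖w (x - t) - w x‖ₑ ^ p := by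
    intro x
    have e : (∫ t, ψ t • w (x - t)) - w x = ∫ t, ψ t • (w (x - t) - w x) := by
      simp only [smul_sub]
      rw [integral_sub (hconv x) (hψi.smul_const _), integral_smul_const, hψ1, one_smul]
    refine le_trans ?_ (rpow_lintegral_mul_le hp
      (ENNReal.measurable_ofReal.comp hψ.measurable).aemeasurable hρ1 (hslice x))
    refine ENNReal.rpow_le_rpow ?_ hp0.le
    rw [e]
    refine (enorm_integral_le_lintegral_enorm _).trans (le_of_eq ?_)
    refine lintegral_congr fun t => ?_
    rw [enorm_smul, Real.enorm_of_nonneg (hψ0 t)]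
  have hbound : ∀ t, ENNReal.ofReal (ψ t) * ∫⁻ x, ‖w (x - t) - w x‖ₑ ^ p ≤
      ENNReal.ofReal (ψ t) * c ^ p := by
    intro t
    by_cases ht : ψ t = 0
    · simp [ht]
    · gcongr
      have h := ENNReal.rpow_le_rpow (hc t ht) hp0.le
      rwa [eLpNorm_eq_lintegral_rpow_enorm_toReal hpn (by simp), ENNReal.toReal_ofReal hp0.le,
        ← ENNReal.rpow_mul, one_div_mul_cancel hp0.ne', ENNReal.rpow_one] at h
  have hmeas : AEMeasurable (Function.uncurry fun x t : E d =>
      ENNReal.ofReal (ψ t) * ‖w (x - t) - w x‖ₑ ^ p)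
      ((volume : Measure (E d)).prod volume) := by
    refine AEMeasurable.mul ?_ (hsub.enorm.pow_const p)
    exact (ENNReal.measurable_ofReal.comp (hψ.measurable.comp measurable_snd)).aemeasurable
  have hfin : ∫⁻ x, ‖(∫ t, ψ t • w (x - t)) - w x‖ₑ ^ p ≤ c ^ p :=
    calc _ ≤ ∫⁻ x, ∫⁻ t, ENNReal.ofReal (ψ t) * ‖w (x - t) - w x‖ₑ ^ p := lintegral_mono hpt
      _ = ∫⁻ t, ∫⁻ x, ENNReal.ofReal (ψ t) * ‖w (x - t) - w x‖ₑ ^ p :=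
          lintegral_lintegral_swap hmeas
      _ = ∫⁻ t, ENNReal.ofReal (ψ t) * ∫⁻ x, ‖w (x - t) - w x‖ₑ ^ p :=
          lintegral_congr fun t => lintegral_const_mul' _ _ ENNReal.ofReal_ne_top
      _ ≤ ∫⁻ t, ENNReal.ofReal (ψ t) * c ^ p := lintegral_mono hbound
      _ = c ^ p := by
          rw [lintegral_mul_const _ hψ.measurable.ennreal_ofReal, hρ1, one_mul]
  rw [eLpNorm_eq_lintegral_rpow_enorm_toReal hpn (by simp), ENNReal.toReal_ofReal hp0.le]
  have h := ENNReal.rpow_le_rpow hfin (by positivity : 0 ≤ 1 / p)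
  rwa [← ENNReal.rpow_mul, mul_one_div_cancel hp0.ne', ENNReal.rpow_one] at h

end Mollify

/-! ### Localisation and mollification of a Sobolev function -/

section Localise

variable {d : ℕ} {Ω : Set (E d)} {p : ℝ}

theorem memLp_continuous_smul (hbdd : Bornology.IsBounded Ω) {η : E d → ℝ} (hη : Continuous η)
    {f : E d → ℂ} {q : ℝ≥0∞} (hf : MemLp f q (volume.restrict Ω)) :
    MemLp (fun x => η x • f x) q (volume.restrict Ω) :=
  MemLp.smul (p := ∞) hf (memLp_of_continuous hbdd hη ∞)

/-- If `∂Ω` does not meet the support of a smooth `θ`, then `1_Ω θ` is smooth. -/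
theorem contDiff_indicator_of_frontier (hΩ : IsOpen Ω) {θ : E d → ℝ} (hθ : ContDiff ℝ ∞ θ)
    (h : ∀ y ∈ frontier Ω, θ =ᶠ[𝓝 y] 0) : ContDiff ℝ ∞ (Ω.indicator θ) := by
  rw [contDiff_iff_contDiffAt]
  intro y
  by_cases hy : y ∈ Ω
  · refine hθ.contDiffAt.congr_of_eventuallyEq ?_
    filter_upwards [hΩ.mem_nhds hy] with z hz
    rw [Set.indicator_of_mem hz]
  · refine (contDiffAt_const (c := (0 : ℝ))).congr_of_eventuallyEq ?_
    by_cases hc : y ∈ closure Ω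
    · have hf : y ∈ frontier Ω := by rw [hΩ.frontier_eq]; exact ⟨hc, hy⟩
      filter_upwards [h y hf] with z hz
      by_cases hzΩ : z ∈ Ω
      · rw [Set.indicator_of_mem hzΩ, hz]; rfl
      · rw [Set.indicator_of_notMem hzΩ]
    · filter_upwards [isClosed_closure.isOpen_compl.mem_nhds hc] with z hz
      rw [Set.indicator_of_notMem fun hzΩ => hz (subset_closure hzΩ)]

theorem tsupport_indicator_subset_of_frontier (hΩ : IsOpen Ω) {θ : E d → ℝ}
    (h : ∀ y ∈ frontier Ω, θ =ᶠ[𝓝 y] 0) : tsupport (Ω.indicator θ) ⊆ Ω := by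
  intro y hy
  by_contra hyΩ
  have hc : y ∈ closure Ω :=
    closure_mono (Function.support_subset_iff'.2 fun z hz => Set.indicator_of_notMem hz _) hy
  have hf : y ∈ frontier Ω := by rw [hΩ.frontier_eq]; exact ⟨hc, hyΩ⟩
  refine notMem_tsupport_iff_eventuallyEq.2 ?_ hy
  filter_upwards [h y hf] with z hz
  by_cases hzΩ : z ∈ Ω
  · rw [Set.indicator_of_mem hzΩ, hz]
  · rw [Set.indicator_of_notMem hzΩ]; rfl

/-- A weak derivative of `η f` may be tested with `y ↦ ψ (x - y)` as soon as `ψ (x - ·) η`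
vanishes near `∂Ω`. -/
theorem integral_partialDeriv_convolution (hΩ : IsOpen Ω) (hbdd : Bornology.IsBounded Ω)
    {i : Fin d} {f g : E d → ℂ} (hf : MemLp f 1 (volume.restrict Ω))
    (hg : MemLp g 1 (volume.restrict Ω)) (hfg : IsWeakDeriv Ω (Pi.single i 1) f g)
    {η ψ : E d → ℝ} (hη : ContDiff ℝ ∞ η) (hψ : ContDiff ℝ ∞ ψ) {x : E d}
    (hx : ∀ y ∈ frontier Ω ∩ tsupport η, x - y ∉ tsupport ψ) :
    ∫ y, partialDeriv i ψ (x - y) • Ω.indicator (fun y => η y • f y) y =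
      ∫ y, ψ (x - y) • Ω.indicator (fun y => partialDeriv i η y • f y + η y • g y) y := by
  set κ : E d → ℝ := fun y => ψ (x - y) with hκ
  have hκs : ContDiff ℝ ∞ κ := hψ.comp (contDiff_const.sub contDiff_id)
  set θ : E d → ℝ := fun y => κ y * η y with hθ
  have hθs : ContDiff ℝ ∞ θ := hκs.mul hη
  have hfr : ∀ y ∈ frontier Ω, θ =ᶠ[𝓝 y] 0 := by
    intro y hy
    by_cases hyη : y ∈ tsupport η
    · have h1 := notMem_tsupport_iff_eventuallyEq.1 (hx y ⟨hy, hyη⟩)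
      have hc : Tendsto (fun z : E d => x - z) (𝓝 y) (𝓝 (x - y)) :=
        (continuous_const.sub continuous_id).tendsto y
      filter_upwards [hc.eventually h1] with z hz
      change ψ (x - z) * η z = 0
      rw [hz]; simp
    · filter_upwards [notMem_tsupport_iff_eventuallyEq.1 hyη] with z hz
      change κ z * η z = 0
      rw [hz]; simp
  have hsupp := tsupport_indicator_subset_of_frontier hΩ hfr
  have hcomp : HasCompactSupport (Ω.indicator θ) :=
    hbdd.isCompact_closure.of_isClosed_subset (isClosed_tsupport _)
      (hsupp.trans subset_closure)
  -- The test function is `1_Ω κ η`. Since `κ η` vanishes near `∂Ω`, the cut-off is smooth with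
  -- compact support in `Ω`.
  have key := hfg.2 _ (contDiff_indicator_of_frontier hΩ hθs hfr) hcomp hsupp
  rw [multiDeriv_single] at key
  -- This sign offsets the one in the definition of the weak derivative.
  have hκd : ∀ y, partialDeriv i κ y = -partialDeriv i ψ (x - y) := by
    intro y
    have h1 : HasFDerivAt (fun z : E d => x - z) (-ContinuousLinearMap.id ℝ (E d)) y :=
      (hasFDerivAt_id y).const_sub x
    have h2 := ((hψ.differentiable (by simp)) (x - y)).hasFDerivAt.comp y h1
    have h3 : fderiv ℝ κ y = _ := h2.fderiv
    simp [partialDeriv, h3]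
  have hder : ∀ y ∈ Ω, partialDeriv i (Ω.indicator θ) y =
      -partialDeriv i ψ (x - y) * η y + κ y * partialDeriv i η y := by
    intro y hy
    have e : Ω.indicator θ =ᶠ[𝓝 y] fun y => κ y * η y := by
      filter_upwards [hΩ.mem_nhds hy] with z hz
      rw [Set.indicator_of_mem hz]
    rw [← hκd]
    simp only [partialDeriv]
    rw [e.fderiv_eq, fderiv_fun_mul ((hκs.differentiable (by simp)) y)
      ((hη.differentiable (by simp)) y)]
    simp [mul_comm, add_comm]
  have hI : ∀ {c : E d → ℝ} {v : E d → ℂ}, Continuous c → MemLp v 1 (volume.restrict Ω) →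
      Integrable (fun y => c y • v y) (volume.restrict Ω) := fun hc hv =>
    memLp_one_iff_integrable.1 (memLp_continuous_smul hbdd hc hv)
  have hψd : Continuous fun y => partialDeriv i ψ (x - y) :=
    (contDiff_partialDeriv i hψ).continuous.comp (continuous_const.sub continuous_id)
  have hηd := (contDiff_partialDeriv i hη).continuous
  have hl : ∫ y in Ω, partialDeriv i (Ω.indicator θ) y • f y =
      -(∫ y in Ω, (partialDeriv i ψ (x - y) * η y) • f y) +
        ∫ y in Ω, (κ y * partialDeriv i η y) • f y := by
    have h1 : Integrable (fun y => -((partialDeriv i ψ (x - y) * η y) • f y))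
        (volume.restrict Ω) := (hI (hψd.mul hη.continuous) hf).neg
    have h2 : Integrable (fun y => (κ y * partialDeriv i η y) • f y) (volume.restrict Ω) :=
      hI (hκs.continuous.mul hηd) hf
    rw [← integral_neg, ← integral_add h1 h2]
    refine setIntegral_congr_fun hΩ.measurableSet fun y hy => ?_
    rw [hder y hy, add_smul, neg_mul, neg_smul]
  have hr : ∫ y in Ω, Ω.indicator θ y • g y = ∫ y in Ω, (κ y * η y) • g y := by
    refine setIntegral_congr_fun hΩ.measurableSet fun y hy => ?_
    simp only [Set.indicator_of_mem hy, hθ]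
  rw [hl, hr, sum_single_eq, pow_one, neg_one_smul] at key
  have e1 : ∀ (c : E d → ℝ) (v : E d → ℂ), ∫ y, c y • Ω.indicator v y = ∫ y in Ω, c y • v y := by
    intro c v
    rw [← integral_indicator hΩ.measurableSet]
    congr 1
    funext y
    by_cases hy : y ∈ Ω <;> simp [hy]
  rw [e1, e1]
  have h1 : Integrable (fun y => (κ y * partialDeriv i η y) • f y) (volume.restrict Ω) :=
    hI (hκs.continuous.mul hηd) hf
  have h2 : Integrable (fun y => (κ y * η y) • g y) (volume.restrict Ω) :=
    hI (hκs.continuous.mul hη.continuous) hg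
  simp only [smul_add, smul_smul]
  rw [integral_add h1 h2]
  linear_combination -key

theorem fderiv_convolution_apply {w : E d → ℂ} (hw : LocallyIntegrable w) {ψ : E d → ℝ}
    (hψ : ContDiff ℝ ∞ ψ) (hψc : HasCompactSupport ψ) (x v : E d) :
    fderiv ℝ (fun x => ∫ t, ψ t • w (x - t)) x v = ∫ t, fderiv ℝ ψ t v • w (x - t) := by
  have h1 : ContDiff ℝ 1 ψ := hψ.of_le (by exact_mod_cast le_top)
  have h := hψc.hasFDerivAt_convolution_left (ContinuousLinearMap.lsmul ℝ ℝ) h1 hw x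
  have he := (hψc.fderiv ℝ).convolutionExists_left
    (ContinuousLinearMap.precompL (E d) (ContinuousLinearMap.lsmul ℝ ℝ))
    (h1.continuous_fderiv (by simp)) hw x
  have h2 : fderiv ℝ (fun x => ∫ t, ψ t • w (x - t)) x = _ := h.fderiv
  rw [h2, convolution_def, ContinuousLinearMap.integral_apply he]
  rfl

/-- Approximation of the piece `η f` of a Sobolev function by smooth functions, when `∂Ω ∩ supp η`
can be moved off the closure of `Ω` by small translations in a fixed direction. -/
theorem exists_contDiff_approx_smul (hΩ : IsOpen Ω) (hbdd : Bornology.IsBounded Ω) (hp : 1 ≤ p)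
    {f : E d → ℂ} {g : Fin d → E d → ℂ} (hf : MemLp f (ENNReal.ofReal p) (volume.restrict Ω))
    (hg : ∀ i, MemLp (g i) (ENNReal.ofReal p) (volume.restrict Ω))
    (hfg : ∀ i, IsWeakDeriv Ω (Pi.single i 1) f (g i)) {η : E d → ℝ} (hη : ContDiff ℝ ∞ η)
    {e : E d} (he : ‖e‖ ≤ 1) {b : ℝ} (hb : 0 < b)
    (hshift : ∀ ε, 0 < ε → ε < b → ∀ y ∈ frontier Ω ∩ tsupport η, y - ε • e ∉ closure Ω)
    {c : ℝ} (hc : 0 < c) :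
    ∃ Φ : E d → ℂ, ContDiff ℝ ∞ Φ ∧
      lpNorm (Φ - fun x => η x • f x) (ENNReal.ofReal p) (volume.restrict Ω) ≤ c ∧
      ∀ i, lpNorm ((fun x => fderiv ℝ Φ x (EuclideanSpace.single i 1)) -
        fun x => partialDeriv i η x • f x + η x • g i x) (ENNReal.ofReal p)
        (volume.restrict Ω) ≤ c := by
  have : IsFiniteMeasure (volume.restrict Ω) :=
    ⟨by rw [Measure.restrict_apply_univ]; exact hbdd.measure_lt_top⟩
  have hηd := fun i => (contDiff_partialDeriv i hη).continuous
  set w : E d → ℂ := Ω.indicator fun x => η x • f x with hw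
  -- `W i` need not be the weak derivative of `w` on the whole space, because `w` can jump across
  -- `∂Ω`. The displaced kernel makes the two agree after mollification, at points of `Ω`.
  set W : Fin d → E d → ℂ := fun i => Ω.indicator fun x => partialDeriv i η x • f x + η x • g i x
    with hW
  have hwm : MemLp w (ENNReal.ofReal p) volume :=
    (memLp_indicator_iff_restrict hΩ.measurableSet).2
      (memLp_continuous_smul hbdd hη.continuous hf)
  have hWm : ∀ i, MemLp (W i) (ENNReal.ofReal p) volume := fun i =>
    (memLp_indicator_iff_restrict hΩ.measurableSet).2
      ((memLp_continuous_smul hbdd (hηd i) hf).add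
        (memLp_continuous_smul hbdd hη.continuous (hg i)))
  have hcpos : (0 : ℝ≥0∞) < ENNReal.ofReal c := by simpa using hc
  have hev : ∀ᶠ h : E d in 𝓝 0,
      eLpNorm (fun x => w (x - h) - w x) (ENNReal.ofReal p) volume ≤ ENNReal.ofReal c ∧
      ∀ i, eLpNorm (fun x => W i (x - h) - W i x) (ENNReal.ofReal p) volume ≤
        ENNReal.ofReal c := by
    refine ((tendsto_eLpNorm_translate hp hwm).eventually_le_const hcpos).and ?_
    exact eventually_all.2 fun i =>
      (tendsto_eLpNorm_translate hp (hWm i)).eventually_le_const hcpos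
  obtain ⟨R, hR, hball⟩ := Metric.eventually_nhds_iff_ball.1 hev
  -- The displacement `ε` and the radius `δ` are both at most `R / 2`, so the kernel is supported in
  -- the ball of radius `R`, where translations change `w` and every `W i` by at most `c`.
  set ε : ℝ := min b R / 2 with hε
  have hε0 : 0 < ε := by have := lt_min hb hR; positivity
  have hεb : ε < b := by have := min_le_left b R; linarith
  have hεR : ε ≤ R / 2 := by have := min_le_right b R; linarith
  -- The displaced boundary piece is compact and misses `closure Ω`, hence lies at positive distance
  -- from it; this leaves room for `δ`.
  set K : Set (E d) := (fun y => y - ε • e) '' (frontier Ω ∩ tsupport η) with hK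
  have hKc : IsCompact K := by
    have hfr : IsCompact (frontier Ω) :=
      hbdd.isCompact_closure.of_isClosed_subset isClosed_frontier frontier_subset_closure
    exact (hfr.inter_right (isClosed_tsupport η)).image (by fun_prop)
  have hdisj : Disjoint K (closure Ω) := by
    rw [Set.disjoint_left]
    rintro _ ⟨y, hy, rfl⟩
    exact hshift ε hε0 hεb y hy
  obtain ⟨δ₀, hδ₀, hthick⟩ := hdisj.exists_cthickenings hKc isClosed_closure
  set δ : ℝ := min δ₀ (R / 2) with hδ
  have hδ0 : 0 < δ := lt_min hδ₀ (by positivity)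
  -- Centred at `-ε e`, the kernel samples `w` within `δ` of `x + ε e`. For `x ∈ Ω` this region
  -- misses `∂Ω ∩ supp η`.
  let B : ContDiffBump (-(ε • e)) := ⟨δ / 2, δ, by positivity, by linarith⟩
  set ψ : E d → ℝ := B.normed volume with hψ
  have hψs : ContDiff ℝ ∞ ψ := B.contDiff_normed
  have hψc : HasCompactSupport ψ := B.hasCompactSupport_normed
  have hψt : tsupport ψ = Metric.closedBall (-(ε • e)) δ := B.tsupport_normed_eq
  have hsupp : ∀ t ∈ Function.support ψ, t ∈ Metric.ball (0 : E d) R := by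
    intro t ht
    have ht' : t ∈ Metric.ball (-(ε • e)) δ := by
      have := B.support_normed_eq (μ := volume)
      rw [← hψ] at this
      rwa [this] at ht
    rw [mem_ball_iff_norm] at ht' ⊢
    have h1 : ‖t - 0‖ ≤ ‖t - -(ε • e)‖ + ‖ε • e‖ := by
      have : t - 0 = (t - -(ε • e)) - ε • e := by abel
      rw [this]; exact norm_sub_le _ _
    have h2 : ‖ε • e‖ ≤ ε := by
      rw [norm_smul, Real.norm_of_nonneg hε0.le]; nlinarith
    have h3 : δ ≤ R / 2 := min_le_right _ _
    linarith
  have hψx : ∀ x ∈ Ω, ∀ y ∈ frontier Ω ∩ tsupport η, x - y ∉ tsupport ψ := by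
    intro x hx y hy hmem
    rw [hψt, Metric.mem_closedBall, dist_eq_norm] at hmem
    refine Set.disjoint_right.1 hthick (Metric.self_subset_cthickening _ (subset_closure hx)) ?_
    refine Metric.mem_cthickening_of_dist_le x (y - ε • e) _ _ ⟨y, hy, rfl⟩ ?_
    have h1 : dist x (y - ε • e) = ‖x - y - -(ε • e)‖ := by
      rw [dist_eq_norm]; congr 1; abel
    rw [h1]
    exact hmem.trans (min_le_left _ _)
  have hwl : LocallyIntegrable w := hwm.locallyIntegrable (one_le_ofReal hp)
  have hψ0 : ∀ x, 0 ≤ ψ x := fun x => B.nonneg_normed x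
  have hψ1 : ∫ x, ψ x = 1 := B.integral_normed
  set Φ : E d → ℂ := fun x => ∫ t, ψ t • w (x - t) with hΦ
  have hΦs : ContDiff ℝ ∞ Φ :=
    hψc.contDiff_convolution_left (ContinuousLinearMap.lsmul ℝ ℝ) hψs hwl
  have hm1 : MemLp f 1 (volume.restrict Ω) := hf.mono_exponent (one_le_ofReal hp)
  have hfd : ∀ i, ∀ x ∈ Ω, fderiv ℝ Φ x (EuclideanSpace.single i 1) =
      ∫ t, ψ t • W i (x - t) := by
    intro i x hx
    have h := integral_partialDeriv_convolution hΩ hbdd hm1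
      ((hg i).mono_exponent (one_le_ofReal hp)) (hfg i) hη hψs (hψx x hx)
    rw [fderiv_convolution_apply hwl hψs hψc,
      ← integral_sub_left_eq_self _ volume x, ← integral_sub_left_eq_self (fun t => ψ t • _) volume x]
    simp only [sub_sub_cancel]
    exact h
  have hconv : ∀ v : E d → ℂ, MemLp v (ENNReal.ofReal p) volume →
      (∀ h ∈ Metric.ball (0 : E d) R,
        eLpNorm (fun x => v (x - h) - v x) (ENNReal.ofReal p) volume ≤ ENNReal.ofReal c) →
      lpNorm (fun x => (∫ t, ψ t • v (x - t)) - v x) (ENNReal.ofReal p) (volume.restrict Ω)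
        ≤ c := by
    intro v hv hvc
    have h := eLpNorm_convolution_sub_le hp hv hψs.continuous hψc hψ0 hψ1
      fun t ht => hvc t (hsupp t ht)
    have hcont : ContDiff ℝ ∞ fun x => ∫ t, ψ t • v (x - t) :=
      hψc.contDiff_convolution_left (ContinuousLinearMap.lsmul ℝ ℝ) hψs
        (hv.locallyIntegrable (one_le_ofReal hp))
    have hm : AEStronglyMeasurable (fun x => (∫ t, ψ t • v (x - t)) - v x) (volume.restrict Ω) :=
      hcont.continuous.aestronglyMeasurable.sub hv.1.restrict
    rw [← toReal_eLpNorm hm]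
    exact ENNReal.toReal_le_of_le_ofReal hc.le ((eLpNorm_restrict_le _ _ _ _).trans h)
  refine ⟨Φ, hΦs, ?_, fun i => ?_⟩
  · refine le_trans (le_of_eq (lpNorm_congr ?_)) (hconv w hwm fun h hh => (hball h hh).1)
    filter_upwards [ae_restrict_mem hΩ.measurableSet] with x hx
    simp [hΦ, hw, hx]
  · refine le_trans (le_of_eq (lpNorm_congr ?_)) (hconv (W i) (hWm i) fun h hh => (hball h hh).2 i)
    filter_upwards [ae_restrict_mem hΩ.measurableSet] with x hx
    simp [hfd i x hx, hW, hx]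

end Localise

/-! ### Density of smooth functions -/

section Density

variable {n : ℕ} {Ω : Set (E (n + 1))} {p : ℝ}

theorem LocalGraphSystem.isOpen_V (S : LocalGraphSystem Ω) (r : Fin S.m) : IsOpen (S.V r) := by
  have hhead : Continuous fun x => headCoord (S.coord r x) :=
    continuous_headCoord.comp (S.coord r).continuous
  have hlast : Continuous fun x => lastCoord (S.coord r x) :=
    continuous_lastCoord.comp (S.coord r).continuous
  have hU : IsOpen {x | headCoord (S.coord r x) ∈ openCube n S.a} :=
    (isOpen_openCube _).preimage hhead
  have hg : ContinuousOn (fun x => S.graph r (headCoord (S.coord r x)) - lastCoord (S.coord r x))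
      {x | headCoord (S.coord r x) ∈ openCube n S.a} :=
    ((S.continuousOn_graph r).comp hhead.continuousOn
      fun x hx => openCube_subset_closedCube _ hx).sub hlast.continuousOn
  have := hg.isOpen_inter_preimage hU (isOpen_Ioo (a := -S.b) (b := S.b))
  rw [S.V_eq]
  convert this using 1
  ext x
  simp only [Set.mem_ofPred_eq, Set.mem_inter_iff, Set.mem_preimage, Set.mem_Ioo]
  constructor
  · rintro ⟨h1, h2, h3⟩; exact ⟨h1, by linarith, by linarith⟩
  · rintro ⟨h1, h2, h3⟩; exact ⟨h1, by linarith, by linarith⟩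

/-- Here `Ω` lying on only one side of its boundary matters: moving down from the graph leads into
the exterior. This supplies the displacement condition of `exists_contDiff_approx_smul`. -/
theorem LocalGraphSystem.sub_smul_inward_notMem (S : LocalGraphSystem Ω) (r : Fin S.m) {ε : ℝ}
    (h0 : 0 < ε) (hb : ε < S.b) {y : E (n + 1)} (hy : y ∈ S.V r ∩ frontier Ω) :
    y - ε • S.inward r ∉ closure Ω := by
  rw [S.V_inter_frontier r] at hy
  obtain ⟨hy1, hy2⟩ := hy
  have : y - ε • S.inward r ∈ S.V r ∩ (closure Ω)ᶜ := by
    rw [S.V_inter_exterior r, sub_eq_add_neg, ← neg_smul]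
    simp only [Set.mem_ofPred_eq, coord_add_smul_inward, headCoord_joinCoord, lastCoord_joinCoord]
    exact ⟨hy1, by linarith, by linarith⟩
  exact this.2

/-- Functions smooth up to the boundary are dense in `W^{1,p}(Ω)`. -/
theorem exists_contDiff_approx (hΩ : IsOpen Ω) (hbdd : Bornology.IsBounded Ω)
    (S : LocalGraphSystem Ω) (hp : 1 ≤ p) {f : E (n + 1) → ℂ} {g : Fin (n + 1) → E (n + 1) → ℂ}
    (hf : MemLp f (ENNReal.ofReal p) (volume.restrict Ω))
    (hg : ∀ i, MemLp (g i) (ENNReal.ofReal p) (volume.restrict Ω))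
    (hfg : ∀ i, IsWeakDeriv Ω (Pi.single i 1) f (g i)) {c : ℝ} (hc : 0 < c) :
    ∃ Φ : E (n + 1) → ℂ, ContDiff ℝ ∞ Φ ∧
      lpNorm (Φ - f) (ENNReal.ofReal p) (volume.restrict Ω) ≤ c ∧
      ∀ i, lpNorm ((fun x => fderiv ℝ Φ x (EuclideanSpace.single i 1)) - g i) (ENNReal.ofReal p)
        (volume.restrict Ω) ≤ c := by
  let U : Option (Fin S.m) → Set (E (n + 1)) := fun o => o.elim Ω S.V
  have hU : ∀ o, IsOpen (U o) := by
    rintro (_ | r)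
    · exact hΩ
    · exact S.isOpen_V r
  have hcov : closure Ω ⊆ ⋃ o, U o := by
    intro x hx
    by_cases hxΩ : x ∈ Ω
    · exact Set.mem_iUnion.2 ⟨none, hxΩ⟩
    · have hf : x ∈ frontier Ω := by rw [hΩ.frontier_eq]; exact ⟨hx, hxΩ⟩
      obtain ⟨r, hr⟩ := Set.mem_iUnion.1 (S.frontier_subset hf)
      exact Set.mem_iUnion.2 ⟨some r, hr⟩
  obtain ⟨P, hP⟩ := SmoothPartitionOfUnity.exists_isSubordinate
    (modelWithCornersSelf ℝ (E (n + 1))) isClosed_closure U hU hcov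
  have hηs : ∀ o, ContDiff ℝ ∞ (P o) := fun o => (P o).contMDiff.contDiff
  have hsum : ∀ x ∈ Ω, ∑ o, P o x = 1 := fun x hx => by
    rw [← finsum_eq_sum_of_fintype]
    exact P.sum_eq_one (subset_closure hx)
  -- This cancels the terms `∂_i P_o • f` when the derivatives of the pieces are added up.
  have hdsum : ∀ i, ∀ x ∈ Ω, ∑ o, partialDeriv i (P o) x = 0 := by
    intro i x hx
    have he : (fun y => ∑ o, P o y) =ᶠ[𝓝 x] fun _ => (1 : ℝ) := by
      filter_upwards [hΩ.mem_nhds hx] with y hy using hsum y hy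
    have h1 := he.fderiv_eq (𝕜 := ℝ)
    rw [fderiv_fun_sum fun o _ => ((hηs o).differentiable (by simp)) x] at h1
    have h2 := congrArg (fun L => L (EuclideanSpace.single i 1)) h1
    simpa [partialDeriv] using h2
  have hN : (0 : ℝ) < Fintype.card (Option (Fin S.m)) := by
    exact_mod_cast Fintype.card_pos
  have hpiece : ∀ o, ∃ Φ : E (n + 1) → ℂ, ContDiff ℝ ∞ Φ ∧
      lpNorm (Φ - fun x => P o x • f x) (ENNReal.ofReal p) (volume.restrict Ω) ≤
        c / Fintype.card (Option (Fin S.m)) ∧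
      ∀ i, lpNorm ((fun x => fderiv ℝ Φ x (EuclideanSpace.single i 1)) -
        fun x => partialDeriv i (P o) x • f x + P o x • g i x) (ENNReal.ofReal p)
        (volume.restrict Ω) ≤ c / Fintype.card (Option (Fin S.m)) := by
    rintro (_ | r)
    -- The interior piece has support inside `Ω`, so no displacement is needed: the condition on
    -- `∂Ω` is vacuous and the length `1` is arbitrary.
    · refine exists_contDiff_approx_smul hΩ hbdd hp hf hg hfg (hηs none) (e := 0) (by simp)
        one_pos (fun ε _ _ y hy => ?_) (by positivity)
      rw [hΩ.frontier_eq] at hy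
      exact absurd (hP none hy.2) hy.1.2
    · exact exists_contDiff_approx_smul hΩ hbdd hp hf hg hfg (hηs (some r))
        (S.norm_inward r).le S.b_pos
        (fun ε h0 hb y hy => S.sub_smul_inward_notMem r h0 hb ⟨hP (some r) hy.2, hy.1⟩)
        (by positivity)
  choose Φ hΦ1 hΦ2 hΦ3 using hpiece
  have hcard : ∑ _o : Option (Fin S.m), c / Fintype.card (Option (Fin S.m)) = c := by
    rw [Finset.sum_const, Finset.card_univ, nsmul_eq_mul]
    field_simp
  refine ⟨fun x => ∑ o, Φ o x, ContDiff.sum fun o _ => hΦ1 o, ?_, fun i => ?_⟩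
  · have h := lpNorm_sum_le (μ := volume.restrict Ω) (p := ENNReal.ofReal p) (s := Finset.univ)
      (f := fun o => Φ o - fun x => P o x • f x)
      (fun o _ => (memLp_of_continuous hbdd (hΦ1 o).continuous _).sub
        (memLp_continuous_smul hbdd (hηs o).continuous hf)) (one_le_ofReal hp)
    refine le_trans (le_of_eq (lpNorm_congr ?_))
      (h.trans ((Finset.sum_le_sum fun o _ => hΦ2 o).trans hcard.le))
    filter_upwards [ae_restrict_mem hΩ.measurableSet] with x hx
    simp only [Finset.sum_apply, Pi.sub_apply, Finset.sum_sub_distrib, ← Finset.sum_smul,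
      hsum x hx, one_smul]
  · have hcd : ∀ o, Continuous fun x => fderiv ℝ (Φ o) x (EuclideanSpace.single i 1) := fun o =>
      continuous_fderiv_single ((hΦ1 o).of_le (by exact_mod_cast le_top)) i
    have h := lpNorm_sum_le (μ := volume.restrict Ω) (p := ENNReal.ofReal p) (s := Finset.univ)
      (f := fun o => (fun x => fderiv ℝ (Φ o) x (EuclideanSpace.single i 1)) -
        fun x => partialDeriv i (P o) x • f x + P o x • g i x)
      (fun o _ => (memLp_of_continuous hbdd (hcd o) _).sub
        ((memLp_continuous_smul hbdd (contDiff_partialDeriv i (hηs o)).continuous hf).add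
          (memLp_continuous_smul hbdd (hηs o).continuous (hg i)))) (one_le_ofReal hp)
    refine le_trans (le_of_eq (lpNorm_congr ?_))
      (h.trans ((Finset.sum_le_sum fun o _ => hΦ3 o i).trans hcard.le))
    filter_upwards [ae_restrict_mem hΩ.measurableSet] with x hx
    simp only [Finset.sum_apply, Pi.sub_apply, Finset.sum_sub_distrib, Finset.sum_add_distrib,
      ← Finset.sum_smul, hsum x hx, hdsum i x hx, one_smul, zero_smul, zero_add]
    rw [fderiv_fun_sum fun o _ => ((hΦ1 o).differentiable (by simp)) x]
    simp

end Density

/-! ### The space `L^p(∂Ω)` -/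

section Boundary

variable {n : ℕ} {Ω : Set (E (n + 1))} {S : LocalGraphSystem Ω} {p : ℝ}

theorem isCompact_closedCube (n : ℕ) (a : ℝ) : IsCompact (closedCube n a) := by
  have h : closedCube n a =
      (WithLp.toLp 2 : (Fin n → ℝ) → E n) '' Set.univ.pi fun _ => Set.Icc (-a) a := by
    ext x
    simp only [closedCube, Set.mem_ofPred_eq, Set.mem_image, Set.mem_univ_pi, Set.mem_Icc,
      ← abs_le]
    exact ⟨fun hx => ⟨WithLp.ofLp x, hx, rfl⟩, by rintro ⟨y, hy, rfl⟩; exact hy⟩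
  rw [h]
  exact (isCompact_univ_pi fun _ => isCompact_Icc).image (PiLp.continuous_toLp 2 _)

theorem volume_openCube_lt_top (n : ℕ) (a : ℝ) : volume (openCube n a) < ⊤ :=
  (measure_mono (openCube_subset_closedCube a)).trans_lt (isCompact_closedCube n a).measure_lt_top

theorem aemeasurable_boundaryPoint (S : LocalGraphSystem Ω) (r : Fin S.m) :
    AEMeasurable (S.boundaryPoint r) (volume.restrict (openCube n S.a)) :=
  (S.continuousOn_boundaryPoint r).aemeasurable (isOpen_openCube _).measurableSet

theorem memLpBoundary_of_continuous (hbdd : Bornology.IsBounded Ω) {φ : E (n + 1) → ℂ}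
    (hφ : Continuous φ) : MemLpBoundary S p φ := by
  intro r
  have : IsFiniteMeasure (volume.restrict (openCube n S.a)) :=
    ⟨by rw [Measure.restrict_apply_univ]; exact volume_openCube_lt_top n S.a⟩
  obtain ⟨C, hC⟩ := hbdd.isCompact_closure.exists_bound_of_continuousOn hφ.continuousOn
  refine MemLp.of_bound
    (hφ.comp_aestronglyMeasurable (aemeasurable_boundaryPoint S r).aestronglyMeasurable) C ?_
  filter_upwards [ae_restrict_mem (isOpen_openCube S.a).measurableSet] with x' hx'
  exact hC _ (frontier_subset_closure (S.boundaryPoint_mem_frontier r hx'))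

theorem MemLpBoundary.sub {g₁ g₂ : E (n + 1) → ℂ} (h₁ : MemLpBoundary S p g₁)
    (h₂ : MemLpBoundary S p g₂) : MemLpBoundary S p (g₁ - g₂) :=
  fun r => (h₁ r).sub (h₂ r)

theorem MemLpBoundary.boundaryNorm_eq (hp : 1 ≤ p) {g : E (n + 1) → ℂ}
    (hg : MemLpBoundary S p g) :
    boundaryNorm S p g = (∑ r, lpNorm (fun x' => g (S.boundaryPoint r x')) (ENNReal.ofReal p)
      (volume.restrict (openCube n S.a)) ^ p) ^ (1 / p) := by
  unfold boundaryNorm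
  congr 1
  exact Finset.sum_congr rfl fun r _ => (lpNorm_rpow_eq hp (hg r).1).symm

theorem boundaryNorm_le_add (hp : 1 ≤ p) {g φ : E (n + 1) → ℂ} (hg : MemLpBoundary S p g)
    (hφ : MemLpBoundary S p φ) :
    boundaryNorm S p g ≤ boundaryNorm S p φ + boundaryNorm S p (φ - g) := by
  have hp0 : 0 < p := by linarith
  rw [hg.boundaryNorm_eq hp, hφ.boundaryNorm_eq hp, (hφ.sub hg).boundaryNorm_eq hp]
  refine le_trans ?_ (Real.Lp_add_le_of_nonneg Finset.univ hp (fun _ _ => lpNorm_nonneg)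
    (fun _ _ => lpNorm_nonneg))
  refine Real.rpow_le_rpow (Finset.sum_nonneg fun _ _ => Real.rpow_nonneg lpNorm_nonneg _)
    (Finset.sum_le_sum fun r _ => ?_) (by positivity)
  exact Real.rpow_le_rpow lpNorm_nonneg
    (lpNorm_le_lpNorm_add_lpNorm_sub (hφ r) (one_le_ofReal hp)) hp0.le

/-- The measure on `∂Ω` whose `L^p` space is `L^p(∂Ω)`. -/
def LocalGraphSystem.boundaryMeasure (S : LocalGraphSystem Ω) : Measure (E (n + 1)) :=
  ∑ r, Measure.map (S.boundaryPoint r) (volume.restrict (openCube n S.a))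

theorem map_le_boundaryMeasure (S : LocalGraphSystem Ω) (r : Fin S.m) :
    Measure.map (S.boundaryPoint r) (volume.restrict (openCube n S.a)) ≤ S.boundaryMeasure :=
  Finset.single_le_sum (f := fun r => Measure.map (S.boundaryPoint r)
    (volume.restrict (openCube n S.a))) (fun _ _ => Measure.zero_le _) (Finset.mem_univ r)

theorem memLpBoundary_of_memLp {g : E (n + 1) → ℂ}
    (hg : MemLp g (ENNReal.ofReal p) S.boundaryMeasure) : MemLpBoundary S p g := by
  intro r
  have h := hg.mono_measure (map_le_boundaryMeasure S r)
  exact (memLp_map_measure_iff h.1 (aemeasurable_boundaryPoint S r)).1 h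

/-- Turns `L^p(∂Ω)` into the `L^p` space of one measure, with overlaps counted once per chart.
Completeness then gives limits as single functions, with no gluing over overlapping charts. -/
theorem boundaryNorm_eq_lpNorm (hp : 1 ≤ p) {g : E (n + 1) → ℂ}
    (hg : MemLp g (ENNReal.ofReal p) S.boundaryMeasure) :
    boundaryNorm S p g = lpNorm g (ENNReal.ofReal p) S.boundaryMeasure := by
  have hp0 : 0 < p := by linarith
  have hi : Integrable (fun x => ‖g x‖ ^ p) S.boundaryMeasure := by
    have := hg.integrable_norm_rpow (by simpa using hp0) (by simp)
    rwa [ENNReal.toReal_ofReal hp0.le] at this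
  have h : lpNorm g (ENNReal.ofReal p) S.boundaryMeasure ^ p =
      ∑ r, ∫ x' in openCube n S.a, ‖g (S.boundaryPoint r x')‖ ^ p := by
    rw [lpNorm_rpow_eq hp hg.1, LocalGraphSystem.boundaryMeasure, integral_finsetSum_measure
      fun r _ => hi.mono_measure (map_le_boundaryMeasure S r)]
    refine Finset.sum_congr rfl fun r _ => ?_
    exact integral_map (aemeasurable_boundaryPoint S r)
      (hi.mono_measure (map_le_boundaryMeasure S r)).1
  rw [boundaryNorm, ← h, one_div, Real.rpow_rpow_inv lpNorm_nonneg hp0.ne']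

theorem memLp_boundaryMeasure_of_continuous (hbdd : Bornology.IsBounded Ω) (hp : 1 ≤ p)
    {φ : E (n + 1) → ℂ} (hφ : Continuous φ) :
    MemLp φ (ENNReal.ofReal p) S.boundaryMeasure := by
  have hp0 : 0 < p := by linarith
  have hpn : ENNReal.ofReal p ≠ 0 := by simpa using hp0
  refine ⟨hφ.aestronglyMeasurable, ?_⟩
  rw [eLpNorm_lt_top_iff_lintegral_rpow_enorm_lt_top hpn (by simp),
    LocalGraphSystem.boundaryMeasure, lintegral_finsetSum_measure]
  refine ENNReal.sum_lt_top.2 fun r _ => ?_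
  rw [← eLpNorm_lt_top_iff_lintegral_rpow_enorm_lt_top hpn (by simp)]
  exact ((memLp_map_measure_iff hφ.aestronglyMeasurable (aemeasurable_boundaryPoint S r)).2
    (memLpBoundary_of_continuous hbdd hφ r)).2

end Boundary

/-! ### First-order Sobolev spaces -/

section FirstOrder

variable {d : ℕ} {Ω : Set (E d)} {p : ℝ} {f φ : E d → ℂ}

theorem eq_zero_or_single_of_sum_le_one {α : Fin d → ℕ} (hα : ∑ i, α i ≤ 1) :
    α = 0 ∨ ∃ i, α = Pi.single i 1 := by
  by_cases h : ∀ i, α i = 0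
  · exact Or.inl (funext h)
  · push Not at h
    obtain ⟨i, hi⟩ := h
    refine Or.inr ⟨i, funext fun j => ?_⟩
    have hsum := Finset.add_sum_erase Finset.univ α (Finset.mem_univ i)
    by_cases hj : j = i
    · subst hj
      rw [Pi.single_eq_same]; omega
    · rw [Pi.single_eq_of_ne hj]
      have := Finset.single_le_sum (f := α) (fun _ _ => Nat.zero_le _)
        (Finset.mem_erase.2 ⟨hj, Finset.mem_univ j⟩)
      omega

/-- `weakDeriv` is chosen separately for each function. This candidate lets the Sobolev norm of `φ -
f` be compared with the differences of derivatives. -/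
theorem isWeakDeriv_contDiff_sub (hp : 1 ≤ p) (hf : MemSobolev Ω 1 p f) (hφ : ContDiff ℝ 1 φ)
    (i : Fin d) :
    IsWeakDeriv Ω (Pi.single i 1) (φ - f)
      ((fun x => fderiv ℝ φ x (EuclideanSpace.single i 1)) - weakDeriv Ω (Pi.single i 1) f) :=
  (isWeakDeriv_of_contDiff hφ i).sub
    (hφ.continuous.locallyIntegrable.locallyIntegrableOn Ω) (hf.locallyIntegrableOn hp)
    (hf.isWeakDeriv (by rw [sum_single_eq]))

theorem memLp_contDiff_sub (hΩ : IsOpen Ω) (hbdd : Bornology.IsBounded Ω)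
    (hf : MemSobolev Ω 1 p f) (hφ : ContDiff ℝ 1 φ) (i : Fin d) :
    MemLp ((fun x => fderiv ℝ φ x (EuclideanSpace.single i 1)) -
      weakDeriv Ω (Pi.single i 1) f) (ENNReal.ofReal p) (volume.restrict Ω) :=
  (memLp_of_continuous hbdd (continuous_fderiv_single hφ i) _).sub
    (hf.memLp_weakDeriv hΩ (by rw [sum_single_eq]))

theorem MemSobolev.contDiff_sub (hΩ : IsOpen Ω) (hbdd : Bornology.IsBounded Ω) (hp : 1 ≤ p)
    (hf : MemSobolev Ω 1 p f) (hφ : ContDiff ℝ 1 φ) : MemSobolev Ω 1 p (φ - f) := by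
  have h0 : MemLp (φ - f) (ENNReal.ofReal p) (volume.restrict Ω) :=
    (memLp_of_continuous hbdd hφ.continuous _).sub hf.1
  refine ⟨h0, fun α hα => ?_⟩
  rcases eq_zero_or_single_of_sum_le_one hα with rfl | ⟨i, rfl⟩
  · exact ⟨_, h0, isWeakDeriv_zero (locallyIntegrableOn_of_memLp hp h0)⟩
  · exact ⟨_, memLp_contDiff_sub hΩ hbdd hf hφ i, isWeakDeriv_contDiff_sub hp hf hφ i⟩

theorem MemSobolev.lpNorm_weakDeriv_zero {m : ℕ} (hΩ : IsOpen Ω) (hp : 1 ≤ p)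
    (hf : MemSobolev Ω m p f) :
    lpNorm (weakDeriv Ω 0 f) (ENNReal.ofReal p) (volume.restrict Ω) =
      lpNorm f (ENNReal.ofReal p) (volume.restrict Ω) :=
  lpNorm_congr ((isWeakDeriv_zero (hf.locallyIntegrableOn hp)).weakDeriv_ae_eq hΩ)

theorem lpNorm_sub_le_sobolevNorm (hΩ : IsOpen Ω) (hbdd : Bornology.IsBounded Ω) (hp : 1 ≤ p)
    (hf : MemSobolev Ω 1 p f) (hφ : ContDiff ℝ 1 φ) :
    lpNorm (φ - f) (ENNReal.ofReal p) (volume.restrict Ω) ≤ sobolevNorm Ω 1 p (φ - f) := by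
  have h := hf.contDiff_sub hΩ hbdd hp hφ
  rw [← h.lpNorm_weakDeriv_zero hΩ hp]
  exact h.lpNorm_weakDeriv_le hΩ hp (by simp)

theorem lpNorm_fderiv_sub_le_sobolevNorm (hΩ : IsOpen Ω) (hbdd : Bornology.IsBounded Ω)
    (hp : 1 ≤ p) (hf : MemSobolev Ω 1 p f) (hφ : ContDiff ℝ 1 φ) (i : Fin d) :
    lpNorm ((fun x => fderiv ℝ φ x (EuclideanSpace.single i 1)) -
      weakDeriv Ω (Pi.single i 1) f) (ENNReal.ofReal p) (volume.restrict Ω) ≤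
      sobolevNorm Ω 1 p (φ - f) := by
  rw [← lpNorm_congr ((isWeakDeriv_contDiff_sub hp hf hφ i).weakDeriv_ae_eq hΩ)]
  exact (hf.contDiff_sub hΩ hbdd hp hφ).lpNorm_weakDeriv_le hΩ hp (by rw [sum_single_eq])

theorem sobolevNorm_sub_le (hΩ : IsOpen Ω) (hbdd : Bornology.IsBounded Ω) (hp : 1 ≤ p)
    (hf : MemSobolev Ω 1 p f) (hφ : ContDiff ℝ 1 φ) {c : ℝ}
    (h0 : lpNorm (φ - f) (ENNReal.ofReal p) (volume.restrict Ω) ≤ c)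
    (h1 : ∀ i, lpNorm ((fun x => fderiv ℝ φ x (EuclideanSpace.single i 1)) -
      weakDeriv Ω (Pi.single i 1) f) (ENNReal.ofReal p) (volume.restrict Ω) ≤ c) :
    sobolevNorm Ω 1 p (φ - f) ≤ ((multiIndices d 1).card : ℝ) ^ (1 / p) * c := by
  have hp0 : 0 < p := by linarith
  have hc : 0 ≤ c := lpNorm_nonneg.trans h0
  have h := hf.contDiff_sub hΩ hbdd hp hφ
  rw [h.sobolevNorm_eq hΩ hp]
  have hle : ∑ α ∈ multiIndices d 1,
      lpNorm (weakDeriv Ω α (φ - f)) (ENNReal.ofReal p) (volume.restrict Ω) ^ p ≤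
      (multiIndices d 1).card * c ^ p := by
    rw [← nsmul_eq_mul]
    refine Finset.sum_le_card_nsmul _ _ _ fun α hα => ?_
    refine Real.rpow_le_rpow lpNorm_nonneg ?_ hp0.le
    rcases eq_zero_or_single_of_sum_le_one (mem_multiIndices.1 hα) with rfl | ⟨i, rfl⟩
    · rwa [h.lpNorm_weakDeriv_zero hΩ hp]
    · rw [lpNorm_congr ((isWeakDeriv_contDiff_sub hp hf hφ i).weakDeriv_ae_eq hΩ)]
      exact h1 i
  refine (Real.rpow_le_rpow (Finset.sum_nonneg fun _ _ => Real.rpow_nonneg lpNorm_nonneg _) hle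
    (by positivity)).trans (le_of_eq ?_)
  rw [Real.mul_rpow (by positivity) (by positivity), one_div, Real.rpow_rpow_inv hc hp0.ne']

theorem tendsto_lpNorm_of_sub {X F : Type*} [MeasurableSpace X] [NormedAddCommGroup F]
    {μ : Measure X} {q : ℝ≥0∞} (hq : 1 ≤ q) {φ : ℕ → X → F} {f : X → F} (hf : MemLp f q μ)
    (hφ : ∀ k, MemLp (φ k) q μ) (h : Tendsto (fun k => lpNorm (φ k - f) q μ) atTop (𝓝 0)) :
    Tendsto (fun k => lpNorm (φ k) q μ) atTop (𝓝 (lpNorm f q μ)) := by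
  rw [tendsto_iff_dist_tendsto_zero]
  refine squeeze_zero (fun _ => dist_nonneg) (fun k => ?_) h
  rw [Real.dist_eq, abs_le]
  have h1 := lpNorm_le_lpNorm_add_lpNorm_sub (hφ k) hq (f := f)
  have h2 := lpNorm_le_lpNorm_add_lpNorm_sub' hf hq (f := φ k)
  exact ⟨by linarith, by linarith⟩

end FirstOrder

/-! ### Traces of functions in `W^{1,p}(Ω)` -/

section Trace

variable {n : ℕ} {Ω : Set (E (n + 1))} {p : ℝ}

/-- The trace inequality for differences of smooth approximations makes their boundary values Cauchy
in `L^p` of `S.boundaryMeasure`; the limit is the trace. -/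
theorem exists_isTrace (hΩ : IsOpen Ω) (hbdd : Bornology.IsBounded Ω) (S : LocalGraphSystem Ω)
    (hp : 1 ≤ p) {f : E (n + 1) → ℂ} (hf : MemSobolev Ω 1 p f) : ∃ g, IsTrace S p f g := by
  have hp0 : 0 < p := by linarith
  have hq := one_le_ofReal hp
  have : Fact (1 ≤ ENNReal.ofReal p) := ⟨hq⟩
  have hle1 : ∀ i : Fin (n + 1), ∑ j, (Pi.single i 1 : Fin (n + 1) → ℕ) j ≤ 1 := fun i => by
    rw [sum_single_eq]
  choose φ hφs hφ0 hφ1 using fun k : ℕ => exists_contDiff_approx hΩ hbdd S hp hf.1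
    (fun i => hf.memLp_weakDeriv hΩ (hle1 i)) (fun i => hf.isWeakDeriv (hle1 i))
    (c := 1 / ((k : ℝ) + 1)) (by positivity)
  have hφ' : ∀ k, ContDiff ℝ 1 (φ k) := fun k => (hφs k).of_le (by exact_mod_cast le_top)
  obtain ⟨C, hC, htr⟩ := exists_boundaryNorm_le S hΩ hbdd hp
  have hmono : ∀ {k N : ℕ}, N ≤ k → 1 / ((k : ℝ) + 1) ≤ 1 / ((N : ℝ) + 1) := fun h =>
    one_div_le_one_div_of_le (by positivity) (by gcongr)
  -- Each of the `n + 2` norms (the function and its `n + 1` derivatives) of the difference is at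
  -- most `2 / (N + 1)`. The exponents `(p - 1) / p` and `1 / p` add to one, so the bound is linear
  -- in this quantity.
  have hcauchy : ∀ k l N : ℕ, N ≤ k → N ≤ l → boundaryNorm S p (φ k - φ l) ≤
      C * ((n : ℝ) + 2) ^ (1 / p) * (2 * (1 / ((N : ℝ) + 1))) := by
    intro k l N hk hl
    set s : ℝ := 2 * (1 / ((N : ℝ) + 1)) with hs
    have hs0 : 0 < s := by positivity
    have key : ∀ {v₁ v₂ v : E (n + 1) → ℂ}, MemLp v₁ (ENNReal.ofReal p) (volume.restrict Ω) →
        MemLp v (ENNReal.ofReal p) (volume.restrict Ω) →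
        lpNorm (v₁ - v) (ENNReal.ofReal p) (volume.restrict Ω) ≤ 1 / ((k : ℝ) + 1) →
        lpNorm (v₂ - v) (ENNReal.ofReal p) (volume.restrict Ω) ≤ 1 / ((l : ℝ) + 1) →
        lpNorm (v₁ - v₂) (ENNReal.ofReal p) (volume.restrict Ω) ≤ s := by
      intro v₁ v₂ v h1 h2 h3 h4
      have h5 := lpNorm_sub_le_lpNorm_sub_add_lpNorm_sub h1 h2 hq (h := v₂)
      rw [lpNorm_sub_comm v v₂] at h5
      have := hmono hk
      have := hmono hl
      linarith
    have hA := key (memLp_of_continuous hbdd (hφ' k).continuous _) hf.1 (hφ0 k) (hφ0 l)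
    have hD : ∀ i, lpNorm (fun x => fderiv ℝ (φ k - φ l) x (EuclideanSpace.single i 1))
        (ENNReal.ofReal p) (volume.restrict Ω) ≤ s := by
      intro i
      have e : (fun x => fderiv ℝ (φ k - φ l) x (EuclideanSpace.single i 1)) =
          (fun x => fderiv ℝ (φ k) x (EuclideanSpace.single i 1)) -
            fun x => fderiv ℝ (φ l) x (EuclideanSpace.single i 1) := by
        funext x
        rw [fderiv_sub (((hφ' k).differentiable (by simp)) x)
          (((hφ' l).differentiable (by simp)) x)]
        rfl
      rw [e]
      exact key (memLp_of_continuous hbdd (continuous_fderiv_single (hφ' k) i) _)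
        (hf.memLp_weakDeriv hΩ (hle1 i)) (hφ1 k i) (hφ1 l i)
    refine (htr (φ k - φ l) ((hφ' k).sub (hφ' l))).trans ?_
    have hsum : lpNorm (φ k - φ l) (ENNReal.ofReal p) (volume.restrict Ω) +
        ∑ i, lpNorm (fun x => fderiv ℝ (φ k - φ l) x (EuclideanSpace.single i 1))
          (ENNReal.ofReal p) (volume.restrict Ω) ≤ ((n : ℝ) + 2) * s := by
      have := Finset.sum_le_card_nsmul Finset.univ _ s fun i _ => hD i
      simp only [Finset.card_univ, Fintype.card_fin, nsmul_eq_mul] at this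
      push_cast at this
      linarith
    have hsum0 : 0 ≤ lpNorm (φ k - φ l) (ENNReal.ofReal p) (volume.restrict Ω) +
        ∑ i, lpNorm (fun x => fderiv ℝ (φ k - φ l) x (EuclideanSpace.single i 1))
          (ENNReal.ofReal p) (volume.restrict Ω) :=
      add_nonneg lpNorm_nonneg (Finset.sum_nonneg fun _ _ => lpNorm_nonneg)
    have he : 0 ≤ (p - 1) / p := div_nonneg (by linarith) hp0.le
    have hss : s ^ ((p - 1) / p) * s ^ (1 / p) = s := by
      rw [← Real.rpow_add hs0, ← add_div, sub_add_cancel, div_self hp0.ne', Real.rpow_one]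
    calc _ ≤ C * s ^ ((p - 1) / p) * (((n : ℝ) + 2) * s) ^ (1 / p) := by
          gcongr
          exact lpNorm_nonneg
      _ = C * ((n : ℝ) + 2) ^ (1 / p) * (s ^ ((p - 1) / p) * s ^ (1 / p)) := by
          rw [Real.mul_rpow (by positivity) hs0.le]; ring
      _ = _ := by rw [hss]
  have hb : ∀ k, MemLp (φ k) (ENNReal.ofReal p) S.boundaryMeasure := fun k =>
    memLp_boundaryMeasure_of_continuous hbdd hp (hφ' k).continuous
  have hdist : ∀ {v₁ v₂ : E (n + 1) → ℂ} (h1 : MemLp v₁ (ENNReal.ofReal p) S.boundaryMeasure)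
      (h2 : MemLp v₂ (ENNReal.ofReal p) S.boundaryMeasure),
      dist (h1.toLp v₁) (h2.toLp v₂) = boundaryNorm S p (v₁ - v₂) := by
    intro v₁ v₂ h1 h2
    rw [boundaryNorm_eq_lpNorm hp (h1.sub h2), ← toReal_eLpNorm (h1.sub h2).1,
      ← Lp.edist_toLp_toLp v₁ v₂ h1 h2, edist_dist, ENNReal.toReal_ofReal dist_nonneg]
  have hlim : Tendsto (fun N : ℕ => 1 / ((N : ℝ) + 1)) atTop (𝓝 0) :=
    tendsto_one_div_add_atTop_nhds_zero_nat
  have hC2 : CauchySeq fun k => (hb k).toLp (φ k) := by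
    refine cauchySeq_of_le_tendsto_0
      (fun N : ℕ => C * ((n : ℝ) + 2) ^ (1 / p) * (2 * (1 / ((N : ℝ) + 1)))) (fun k l N hk hl => ?_) ?_
    · rw [hdist]
      exact hcauchy k l N hk hl
    · simpa using (hlim.const_mul 2).const_mul (C * ((n : ℝ) + 2) ^ (1 / p))
  obtain ⟨G, hG⟩ := cauchySeq_tendsto_of_complete hC2
  refine ⟨G, hf, memLpBoundary_of_memLp (Lp.memLp G), φ, hφs, ?_, ?_⟩
  · refine squeeze_zero (fun _ => sobolevNorm_nonneg)
      (fun k => sobolevNorm_sub_le hΩ hbdd hp hf (hφ' k) (hφ0 k) (hφ1 k)) ?_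
    simpa using hlim.const_mul (((multiIndices (n + 1) 1).card : ℝ) ^ (1 / p))
  · have h := tendsto_iff_dist_tendsto_zero.1 hG
    refine h.congr fun k => ?_
    rw [← hdist (hb k) (Lp.memLp G), Lp.toLp_coeFn]

/-- The multiplicative trace inequality in `W^{1,p}(Ω)`. -/
theorem exists_boundaryNorm_trace_le (hΩ : IsOpen Ω) (hbdd : Bornology.IsBounded Ω)
    (S : LocalGraphSystem Ω) (hp : 1 ≤ p) :
    ∃ C : ℝ, 0 < C ∧ ∀ f g : E (n + 1) → ℂ, IsTrace S p f g →
      boundaryNorm S p g ≤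
        C * lpNorm (weakDeriv Ω 0 f) (ENNReal.ofReal p) (volume.restrict Ω) ^ ((p - 1) / p) *
          (lpNorm (weakDeriv Ω 0 f) (ENNReal.ofReal p) (volume.restrict Ω) +
            ∑ i, lpNorm (weakDeriv Ω (Pi.single i 1) f) (ENNReal.ofReal p)
              (volume.restrict Ω)) ^ (1 / p) := by
  have hp0 : 0 < p := by linarith
  have hq := one_le_ofReal hp
  obtain ⟨C, hC, htr⟩ := exists_boundaryNorm_le S hΩ hbdd hp
  refine ⟨C, hC, ?_⟩
  rintro f g ⟨hf, hg, φ, hφs, hφf, hφg⟩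
  have hφ' : ∀ k, ContDiff ℝ 1 (φ k) := fun k => (hφs k).of_le (by exact_mod_cast le_top)
  rw [hf.lpNorm_weakDeriv_zero hΩ hp]
  have hA := tendsto_lpNorm_of_sub hq hf.1
    (fun k => memLp_of_continuous hbdd (hφ' k).continuous _)
    (squeeze_zero (fun _ => lpNorm_nonneg)
      (fun k => lpNorm_sub_le_sobolevNorm hΩ hbdd hp hf (hφ' k)) hφf)
  have hD := fun i : Fin (n + 1) => tendsto_lpNorm_of_sub hq
    (hf.memLp_weakDeriv hΩ (α := Pi.single i 1) (by rw [sum_single_eq]))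
    (fun k => memLp_of_continuous hbdd (continuous_fderiv_single (hφ' k) i) _)
    (squeeze_zero (fun _ => lpNorm_nonneg)
      (fun k => lpNorm_fderiv_sub_le_sobolevNorm hΩ hbdd hp hf (hφ' k) i) hφf)
  -- The bound for `φ k` plus the boundary distance from `φ k` to `g` majorises the norm of `g` and
  -- converges to the claimed right-hand side. Uniqueness of the trace plays no role.
  have hR := (((hA.rpow_const (p := (p - 1) / p)
    (Or.inr (div_nonneg (by linarith) hp0.le))).const_mul C).mul
    ((hA.add (tendsto_finsetSum Finset.univ fun i _ => hD i)).rpow_const (p := 1 / p)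
      (Or.inr (by positivity)))).add hφg
  rw [add_zero] at hR
  refine ge_of_tendsto' hR fun k => ?_
  refine (boundaryNorm_le_add hp hg
    (memLpBoundary_of_continuous hbdd (hφ' k).continuous)).trans ?_
  gcongr
  exact htr _ (hφ' k)

end Trace

end SobolevTrace

end

open SobolevTrace in
theorem proposition7p5 (n : ℕ) (Ω : Set (E (n + 1))) (hopen : IsOpen Ω) (hconn : IsConnected Ω)
    (hbdd : Bornology.IsBounded Ω) (S : LocalGraphSystem Ω) (hS : S.IsOfClass 3 1)
    (p : ℝ) (hp : 1 ≤ p) :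
    ∃ c : ℝ, 0 < c ∧ ∀ u : E (n + 1) → ℂ, MemSobolev Ω 3 p u →
      (∃ g, IsTrace S p (weakLaplacian Ω u) g) ∧
      ∀ g, IsTrace S p (weakLaplacian Ω u) g →
        boundaryNorm S p g ≤
          c * sobolevNorm Ω 2 p u ^ ((p - 1) / p) * sobolevNorm Ω 3 p u ^ (1 / p) := by
  have hp0 : 0 < p := by linarith
  obtain ⟨C, hC, htr⟩ := exists_boundaryNorm_trace_le hopen hbdd S hp
  refine ⟨C * ((n : ℝ) + 1) ^ ((p - 1) / p) * (((n : ℝ) + 2) * ((n : ℝ) + 1)) ^ (1 / p),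
    by positivity, fun u hu => ⟨?_, fun g hg => ?_⟩⟩
  · exact exists_isTrace hopen hbdd S hp
      (MemSobolev.memSobolev_weakLaplacian (m := 1) hopen hp hu)
  -- The norm of `Δu` is estimated twice: by `‖u‖_{2,p}` for the factor with exponent `(p - 1) / p`,
  -- and by `‖u‖_{3,p}` where it stands beside its gradient.
  · have hA2 := (hu.mono (by norm_num : 2 ≤ 3)).lpNorm_weakDeriv_weakLaplacian_le hopen hp
      (γ := 0) (by simp)
    have hA3 := hu.lpNorm_weakDeriv_weakLaplacian_le hopen hp (γ := 0) (by simp)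
    have hD := fun i : Fin (n + 1) => hu.lpNorm_weakDeriv_weakLaplacian_le hopen hp
      (γ := Pi.single i 1) (by rw [sum_single_eq])
    push_cast at hA2 hA3 hD
    have hsum : lpNorm (weakDeriv Ω 0 (weakLaplacian Ω u)) (ENNReal.ofReal p)
          (volume.restrict Ω) +
        ∑ i, lpNorm (weakDeriv Ω (Pi.single i 1) (weakLaplacian Ω u)) (ENNReal.ofReal p)
          (volume.restrict Ω) ≤
        (((n : ℝ) + 2) * ((n : ℝ) + 1)) * sobolevNorm Ω 3 p u := by
      have := Finset.sum_le_card_nsmul Finset.univ _ _ fun i _ => hD i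
      simp only [Finset.card_univ, Fintype.card_fin, nsmul_eq_mul] at this
      push_cast at this
      linarith
    have hsum0 : 0 ≤ lpNorm (weakDeriv Ω 0 (weakLaplacian Ω u)) (ENNReal.ofReal p)
          (volume.restrict Ω) +
        ∑ i, lpNorm (weakDeriv Ω (Pi.single i 1) (weakLaplacian Ω u)) (ENNReal.ofReal p)
          (volume.restrict Ω) :=
      add_nonneg lpNorm_nonneg (Finset.sum_nonneg fun _ _ => lpNorm_nonneg)
    have h2 : 0 ≤ sobolevNorm Ω 2 p u := sobolevNorm_nonneg
    have h3 : 0 ≤ sobolevNorm Ω 3 p u := sobolevNorm_nonneg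
    have he : 0 ≤ (p - 1) / p := div_nonneg (by linarith) hp0.le
    calc boundaryNorm S p g
        ≤ C * (((n : ℝ) + 1) * sobolevNorm Ω 2 p u) ^ ((p - 1) / p) *
          ((((n : ℝ) + 2) * ((n : ℝ) + 1)) * sobolevNorm Ω 3 p u) ^ (1 / p) := by
          refine (htr _ g hg).trans ?_
          gcongr
          exact lpNorm_nonneg
      _ = _ := by
          rw [Real.mul_rpow (by positivity) h2, Real.mul_rpow (by positivity) h3]
          ring
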